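/- Let $n\ge 3$ and let $X$ be a smooth oriented Riemannian manifold of dimension $n$ with boundary $M$, with Levi-Civita connection $\nabla$. Let $\vec n$ be the outward unit normal vector field of $M$, let $\pi:STX\to X$ be the bundle of unit tangent vectors, and let $$CSTM=STX|_M\setminus(\vec n(M)\cup(-\vec n)(M)).$$ For $v\in CSTM$ let $\phi(v)\in(0,\pi)$ be the angle between $v$ and $\vec n$, let $\partial v$ be the orthogonal projection of $v$ to $TM$, and let $p(v)=\partial v/|\partial v|\in STM$. Let $\partial/\partial\phi$ be the vector field on $CSTM$ with $d\phi(\partial/\partial\phi)=1$ and $dp(\partial/\partial\phi)=0$, that is, the coordinate field of the diffeomorphism $(\phi,p):CSTM\to(0,\pi)\times STM$. For a positively oriented orthonormal frame $(e_1,\dots,e_n)$ of $TX$ (a local frame on $X$, or more generally a local frame of $\pi^*TX$) put $$\nabla e_A=\sum_B\omega_{AB}e_B,\qquad \Omega_{AB}=d\omega_{AB}-\sum_C\omega_{AC}\wedge\omega_{CB},\qquad v=\sum_A u_A(v)e_A,\qquad \theta_A=du_A+\sum_B u_B\,\omega_{BA}.$$ With products of forms meaning exterior products, put $$\Phi_k=\sum_{A\in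 S_n}\epsilon(A)\,u_{A_1}\theta_{A_2}\cdots\theta_{A_{n-2k}}\,\Omega_{A_{n-2k+1}A_{n-2k+2}}\cdots\Omega_{A_{n-1}A_n},$$ $$\Phi=\frac1{(n-2)!!\,c_{n-1}}\sum_{k=0}^{\lfloor (n-1)/2\rfloor}\frac{(-1)^k}{2^k\,k!\,(n-2k-1)!!}\,\Phi_k ,$$ where $A$ runs over the permutations of $\{1,\dots,n\}$, $\epsilon(A)$ is the sign of $A$, and $c_{n-1}$ is the volume of the unit sphere $S^{n-1}$. Near a point of $CSTM$ choose an adapted frame: a smooth positively oriented orthonormal frame $(e_1,\dots,e_n)$ of $\pi^*TX$ over an open subset of $CSTM$ with $e_1=\vec n$ and $e_n(v)=p(v)$. Let $\omega_{AB}$ be its connection forms, and let $\Omega^M_{st}$ ($2\le s,t\le n$) be the curvature forms, in the frame $(e_2,\dots,e_n)$ of $TM$, of the metric induced on $M$. For $i,j\ge0$ with $2i+j\le n-2$ put $$\Phi^M(i,j)=\sum_\alpha\epsilon(\alpha)\,\omega_{1\alpha_2}\cdots\omega_{1\alpha_{n-2i-j-1}}\,\Omega^M_{\alpha_{n-2i-j}\alpha_{n-2i-j+1}}\cdots\Omega^M_{\alpha_{n-j-2}\alpha_{n-j-1}}\,\omega_{\alpha_{n-j}n}\cdots\omega_{\alpha_{n-1}n},$$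 where $\alpha$ runs over the permutations of $\{2,\dots,n-1\}$. Then, on $CSTM$, the form $\Upsilon:=\iota_{\partial/\partial\phi}\Phi$ is given by $$\Upsilon=\frac{1}{(n-2)!!\,c_{n-1}}\sum_{(i,j)\in D_1}a(i,j)(\phi)\,\Phi^M(i,j),\qquad D_1=\{(i,j)\in\mathbb Z^2: i\ge0,\ j\ge0,\ 2i+j\le n-2\},$$ $$a(i,j)(\phi)=\sum_{k=i}^{\lfloor (n-j)/2\rfloor-1}(-1)^{n+j+k}\,\frac{(n-2k-2)!!}{2^k\,j!\,(n-2k-j-2)!\,i!\,(k-i)!}\,\cos^{n-2k-j-2}\phi\,\sin^j\phi ,$$ for every choice of the frame used to compute $\Phi$ and of the adapted frame. -/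

import Mathlib

open Bundle Set
open scoped Manifold ContDiff Nat

noncomputable section

/-! ### Exterior forms on open subsets of `ℝᵐ` -/

/-- The algebra of exterior forms at a point of `ℝᵐ`: the exterior algebra of the dual space.
A differential form on an open subset of `ℝᵐ` is a function with values in this algebra, and
the product of the algebra is the exterior product. -/
abbrev ExtForms (m : ℕ) : Type :=
  ExteriorAlgebra ℝ (StrongDual ℝ (EuclideanSpace ℝ (Fin m)))

/-- A linear functional regarded as an exterior form of degree one. -/
def toForm {m : ℕ} (β : StrongDual ℝ (EuclideanSpace ℝ (Fin m))) : ExtForms m :=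
  ExteriorAlgebra.ι ℝ β

/-- The coordinate vector `∂ᵢ` of `ℝᵐ`. -/
def coordVec {m : ℕ} (i : Fin m) : EuclideanSpace ℝ (Fin m) :=
  EuclideanSpace.single i 1

/-- The coordinate differential `dxⁱ` of `ℝᵐ`. -/
def coordForm {m : ℕ} (i : Fin m) : StrongDual ℝ (EuclideanSpace ℝ (Fin m)) :=
  EuclideanSpace.proj i

/-- The exterior derivative of a one-form, `dβ = ∑ᵢ dxⁱ ∧ ∂ᵢβ`. -/
def extD {m : ℕ} (β : EuclideanSpace ℝ (Fin m) → StrongDual ℝ (EuclideanSpace ℝ (Fin m)))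
    (y : EuclideanSpace ℝ (Fin m)) : ExtForms m :=
  ∑ i, toForm (coordForm i) * toForm (fderiv ℝ β y (coordVec i))

/-- The interior product with the tangent vector `ζ`: the antiderivation of the exterior algebra
that sends a one-form `β` to `β ζ`. -/
def interiorProd {m : ℕ} (ζ : EuclideanSpace ℝ (Fin m)) : ExtForms m →ₗ[ℝ] ExtForms m :=
  CliffordAlgebra.contractLeft
    (ContinuousLinearMap.apply ℝ ℝ ζ : StrongDual ℝ (EuclideanSpace ℝ (Fin m)) →L[ℝ] ℝ).toLinearMap

/-! ### Connection forms and curvature forms of a metric given in coordinates -/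

section LocalGeometry

variable {F : Type*} [NormedAddCommGroup F] [NormedSpace ℝ F]

/-- The Christoffel symbol of the first kind `⟨∇_a b, c⟩` (for constant vector fields `a b c`) at
the point `q` of the metric `G` on the subset `S` of the vector space `F`. -/
def christoffel (G : F → F → F → ℝ) (S : Set F) (q a b c : F) : ℝ :=
  (fderivWithin ℝ (fun p ↦ G p b c) S q a + fderivWithin ℝ (fun p ↦ G p a c) S q b
    - fderivWithin ℝ (fun p ↦ G p a b) S q c) / 2

/-- Let `q` be a map from an open subset of `ℝᵐ` to `S`, and let `a`, `b` be vector fields along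
`q`. This is the one-form `ξ ↦ ⟨∇_ξ a, b⟩`, where `∇` is the pullback by `q` of the
Levi-Civita connection of the metric `G` on `S`. -/
def connForm {m : ℕ} (G : F → F → F → ℝ) (S : Set F) (q a b : EuclideanSpace ℝ (Fin m) → F)
    (y : EuclideanSpace ℝ (Fin m)) : StrongDual ℝ (EuclideanSpace ℝ (Fin m)) :=
  ∑ i, (G (q y) (fderiv ℝ a y (coordVec i)) (b y)
    + christoffel G S (q y) (fderiv ℝ q y (coordVec i)) (a y) (b y)) • coordForm i

end LocalGeometry

/-- The curvature forms `Ω_AB = dω_AB - ∑_C ω_AC ∧ ω_CB` of the connection forms `ω = conn`, where `C`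
runs over the index set `s` of the frame. -/
def curvForm {m n : ℕ} (s : Finset (Fin n))
    (conn : Fin n → Fin n → EuclideanSpace ℝ (Fin m) → StrongDual ℝ (EuclideanSpace ℝ (Fin m)))
    (A B : Fin n) (y : EuclideanSpace ℝ (Fin m)) : ExtForms m :=
  extD (conn A B) y - ∑ C ∈ s, toForm (conn A C y) * toForm (conn C B y)

/-! ### Riemannian manifolds with boundary -/

section Manifold

variable {n : ℕ} [NeZero n] {X : Type*} [TopologicalSpace X]
  [ChartedSpace (EuclideanHalfSpace n) X] [IsManifold (𝓡∂ n) ∞ X]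

/-- The tangent bundle of the `n`-dimensional manifold with boundary `X`, in the chart at `x₀`:
the coordinate vector in `ℝⁿ` of a tangent vector at a point of the domain of the chart. -/
def chartVec (x₀ : X) {x : X} (w : TangentSpace (𝓡∂ n) x) : EuclideanSpace ℝ (Fin n) :=
  (trivializationAt (EuclideanSpace ℝ (Fin n)) (TangentSpace (𝓡∂ n)) x₀
    (⟨x, w⟩ : TangentBundle (𝓡∂ n) X)).2

variable (n X) in
/-- An orientation of `X`: an orientation of every tangent space that is locally constant in
charts. -/
structure TangentOrientation where
  /-- The orientation of the tangent space at a point. -/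
  at' : ∀ x : X, Orientation ℝ (TangentSpace (𝓡∂ n) x) (Fin n)
  locallyConstant : ∀ x₀ : X, ∀ᶠ x in nhds x₀,
    ∀ hx : x ∈ (trivializationAt (EuclideanSpace ℝ (Fin n)) (TangentSpace (𝓡∂ n)) x₀).baseSet,
      Orientation.map (Fin n) ((trivializationAt (EuclideanSpace ℝ (Fin n))
        (TangentSpace (𝓡∂ n)) x₀).continuousLinearEquivAt ℝ x hx).toLinearEquiv (at' x)
      = Orientation.map (Fin n) ((trivializationAt (EuclideanSpace ℝ (Fin n))
        (TangentSpace (𝓡∂ n)) x₀).continuousLinearEquivAt ℝ x₀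
          (FiberBundle.mem_baseSet_trivializationAt' x₀)).toLinearEquiv (at' x₀)

variable [RiemannianBundle (fun x : X ↦ TangentSpace (𝓡∂ n) x)]

/-- The Riemannian metric of `X` in the chart at `x₀`, as a function of the point `q` of the half
space `{q | 0 ≤ q 0}` and of two coordinate vectors. -/
def metricInChart (x₀ : X) (q a b : EuclideanSpace ℝ (Fin n)) : ℝ :=
  inner ℝ
    ((trivializationAt (EuclideanSpace ℝ (Fin n)) (TangentSpace (𝓡∂ n)) x₀).symm
      ((extChartAt (𝓡∂ n) x₀).symm q) a)
    ((trivializationAt (EuclideanSpace ℝ (Fin n)) (TangentSpace (𝓡∂ n)) x₀).symm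
      ((extChartAt (𝓡∂ n) x₀).symm q) b)

variable (n) in
/-- The boundary hyperplane `{q | q 0 = 0}` of the half space, in which the restriction of a chart
of `X` to the boundary takes its values. -/
abbrev BoundaryModel : Submodule ℝ (EuclideanSpace ℝ (Fin n)) :=
  LinearMap.ker (EuclideanSpace.proj (0 : Fin n) : EuclideanSpace ℝ (Fin n) →L[ℝ] ℝ).toLinearMap

variable (n) in
/-- The projection `(q₀, q₁, …, qₙ₋₁) ↦ (0, q₁, …, qₙ₋₁)` to the boundary hyperplane. -/
def toBoundaryModel (q : EuclideanSpace ℝ (Fin n)) : BoundaryModel n :=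
  (BoundaryModel n).orthogonalProjectionOnto q

/-- The metric induced on the boundary of `X`, in the restriction to the boundary of the chart of
`X` at `x₀`. -/
def boundaryMetricInChart (x₀ : X) (q a b : BoundaryModel n) : ℝ :=
  metricInChart x₀ (q : EuclideanSpace ℝ (Fin n)) a b

variable {m : ℕ} {x : EuclideanSpace ℝ (Fin m) → X}

/-- Let `e` be a frame of `TX` along the map `x` from an open subset of `ℝᵐ` to the domain of the
chart at `x₀`. These are the one-forms `ω_AB = ⟨∇ e_A, e_B⟩`, for the (pulled back) Levi-Civita
connection `∇` of `X`. -/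
def omegaX (x₀ : X) (e : Fin n → ∀ z, TangentSpace (𝓡∂ n) (x z)) (A B : Fin n) :
    EuclideanSpace ℝ (Fin m) → StrongDual ℝ (EuclideanSpace ℝ (Fin m)) :=
  connForm (metricInChart x₀) (range (𝓡∂ n)) (fun z ↦ extChartAt (𝓡∂ n) x₀ (x z))
    (fun z ↦ chartVec x₀ (e A z)) (fun z ↦ chartVec x₀ (e B z))

/-- The curvature forms `Ω_AB` of `X`. -/
def OmegaX (x₀ : X) (e : Fin n → ∀ z, TangentSpace (𝓡∂ n) (x z)) (A B : Fin n) :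
    EuclideanSpace ℝ (Fin m) → ExtForms m :=
  curvForm Finset.univ (omegaX x₀ e) A B

/-- The connection forms of the Levi-Civita connection of the metric induced on the boundary `M`
of `X`. They are used when `x` takes its values in `M` and `e_A`, `e_B` are tangent to `M`. -/
def omegaM (x₀ : X) (e : Fin n → ∀ z, TangentSpace (𝓡∂ n) (x z)) (A B : Fin n) :
    EuclideanSpace ℝ (Fin m) → StrongDual ℝ (EuclideanSpace ℝ (Fin m)) :=
  connForm (boundaryMetricInChart x₀) univ
    (fun z ↦ toBoundaryModel n (extChartAt (𝓡∂ n) x₀ (x z)))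
    (fun z ↦ toBoundaryModel n (chartVec x₀ (e A z)))
    (fun z ↦ toBoundaryModel n (chartVec x₀ (e B z)))

/-- The curvature forms `Ω^M_st` of the metric induced on the boundary `M`, for a frame `e` whose
first vector is normal to `M` and whose other vectors form a frame of `TM`. -/
def OmegaM (x₀ : X) (e : Fin n → ∀ z, TangentSpace (𝓡∂ n) (x z)) (s t : Fin n) :
    EuclideanSpace ℝ (Fin m) → ExtForms m :=
  curvForm (Finset.univ.erase 0) (omegaM x₀ e) s t

/-- `e` is a positively oriented orthonormal basis of the tangent space at `x`. -/
def IsOrientedFrame (o : TangentOrientation n X) {x : X} (e : Fin n → TangentSpace (𝓡∂ n) x) :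
    Prop :=
  Orthonormal ℝ e ∧
    ∃ b : Module.Basis (Fin n) ℝ (TangentSpace (𝓡∂ n) x), (∀ A, b A = e A) ∧ b.orientation = o.at' x

/-- The vectors `e A z`, `z ∈ U`, form a smooth positively oriented orthonormal frame of `TX`
along the map `x`. -/
structure IsOrientedFrameAlong (o : TangentOrientation n X) (U : Set (EuclideanSpace ℝ (Fin m)))
    (e : Fin n → ∀ z, TangentSpace (𝓡∂ n) (x z)) : Prop where
  smooth : ∀ A, ContMDiffOn 𝓘(ℝ, EuclideanSpace ℝ (Fin m)) (𝓡∂ n).tangent ∞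
    (fun z ↦ (⟨x z, e A z⟩ : TangentBundle (𝓡∂ n) X)) U
  oriented : ∀ z ∈ U, IsOrientedFrame o (fun A ↦ e A z)

/-! ### The normal vector, the angle, and the cylinder -/

/-- `ν` is the outward unit normal vector of the boundary at the boundary point `x`: it has length
one, is orthogonal to the tangent space `{w | w 0 = 0}` of the boundary, and points out of the
half space. (Tangent vectors at `x` are identified with `ℝⁿ` through the chart at `x`.) -/
def IsOutwardUnitNormal (x : X) (ν : TangentSpace (𝓡∂ n) x) : Prop :=
  ‖ν‖ = 1 ∧ chartVec x ν 0 < 0 ∧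
    ∀ w : TangentSpace (𝓡∂ n) x, chartVec x w 0 = 0 → inner ℝ ν w = 0

open Classical in
/-- The outward unit normal vector of the boundary at the boundary point `x`. -/
def outwardNormal (x : X) : TangentSpace (𝓡∂ n) x :=
  if h : ∃ ν, IsOutwardUnitNormal x ν then h.choose else 0

variable (n X) in
/-- The set of all unit tangent vectors of `X` at points of the boundary, except the
outward and inward unit normal vectors. -/
def CSTM : Set (TangentBundle (𝓡∂ n) X) :=
  {v | v.proj ∈ (𝓡∂ n).boundary X ∧ ‖v.2‖ = 1 ∧
    v.2 ≠ outwardNormal v.proj ∧ v.2 ≠ -outwardNormal v.proj}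

/-- The angle between `v` and the outward normal. -/
def normalAngle {x : X} (v : TangentSpace (𝓡∂ n) x) : ℝ :=
  InnerProductGeometry.angle v (outwardNormal x)

/-- The projection `∂v` of `v` to the tangent space of the boundary. -/
def tangentialPart {x : X} (v : TangentSpace (𝓡∂ n) x) : TangentSpace (𝓡∂ n) x :=
  v - (inner ℝ v (outwardNormal x) : ℝ) • outwardNormal x

/-- The projection `v ↦ ∂v / |∂v|` from `CSTM` to the unit tangent vectors of the boundary. -/
def equatorProj {x : X} (v : TangentSpace (𝓡∂ n) x) : TangentSpace (𝓡∂ n) x :=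
  ‖tangentialPart v‖⁻¹ • tangentialPart v

/-- At the point `y`, the map `z ↦ v z` into `CSTM` sends the tangent vector `ζ` to the vector
`∂/∂φ`, where `φ` is the first coordinate of the identification `v ↦ (φ(v), p(v))` of `CSTM` with
the product of `(0, π)` and the unit tangent bundle of the boundary: the derivative of `φ` is
one, and the derivative of `p` is zero. -/
structure LiftsAngleField (v : ∀ z, TangentSpace (𝓡∂ n) (x z)) (y ζ : EuclideanSpace ℝ (Fin m)) :
    Prop where
  angle : fderiv ℝ (fun z ↦ normalAngle (v z)) y ζ = 1
  equator : mfderiv 𝓘(ℝ, EuclideanSpace ℝ (Fin m)) (𝓡∂ n).tangent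
    (fun z ↦ (⟨x z, equatorProj (v z)⟩ : TangentBundle (𝓡∂ n) X)) y ζ = 0

/-! ### The secondary Chern-Euler form -/

/-- The function `u_A`, the component of `v` along `e_A`. -/
def uCoord (e : Fin n → ∀ z, TangentSpace (𝓡∂ n) (x z)) (v : ∀ z, TangentSpace (𝓡∂ n) (x z))
    (A : Fin n) (z : EuclideanSpace ℝ (Fin m)) : ℝ :=
  inner ℝ (v z) (e A z)

/-- The one-form `θ_A = du_A + ∑_B u_B ω_BA`. -/
def thetaForm (x₀ : X) (e : Fin n → ∀ z, TangentSpace (𝓡∂ n) (x z))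
    (v : ∀ z, TangentSpace (𝓡∂ n) (x z)) (A : Fin n) (y : EuclideanSpace ℝ (Fin m)) :
    StrongDual ℝ (EuclideanSpace ℝ (Fin m)) :=
  fderiv ℝ (uCoord e v A) y + ∑ B, uCoord e v B y • omegaX x₀ e B A y

/-- The form `Φ_k = ∑_A ε(A) u_{A₁} θ_{A₂} ⋯ θ_{A_{n-2k}} Ω_{A_{n-2k+1} A_{n-2k+2}} ⋯
Ω_{A_{n-1} A_n}`, pulled back by the map `z ↦ v z` to the unit tangent bundle of `X`. The indices
`1, …, n` are represented by `0, …, n - 1`, and `2 k < n`. -/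
def PhiK (x₀ : X) (e : Fin n → ∀ z, TangentSpace (𝓡∂ n) (x z))
    (v : ∀ z, TangentSpace (𝓡∂ n) (x z)) (k : ℕ) (y : EuclideanSpace ℝ (Fin m)) : ExtForms m :=
  ∑ A : Equiv.Perm (Fin n), (((Equiv.Perm.sign A : ℤ) : ℝ) * uCoord e v (A 0) y) •
    (((List.range (n - 2 * k - 1)).map fun l ↦
        toForm (thetaForm x₀ e v (A (Fin.ofNat n (l + 1))) y)).prod
      * ((List.range k).map fun l ↦
        OmegaX x₀ e (A (Fin.ofNat n (n - 2 * k + 2 * l)))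
          (A (Fin.ofNat n (n - 2 * k + 2 * l + 1))) y).prod)

/-- The volume of the unit sphere of `ℝⁿ`, which has dimension `n - 1`. -/
def sphereVolume (n : ℕ) : ℝ :=
  (MeasureTheory.volume : MeasureTheory.Measure (EuclideanSpace ℝ (Fin n))).toSphere.real univ

/-- The secondary Chern-Euler form `Φ`, pulled back by the map `z ↦ v z` to the unit tangent bundle
of `X`. -/
def PhiForm (x₀ : X) (e : Fin n → ∀ z, TangentSpace (𝓡∂ n) (x z))
    (v : ∀ z, TangentSpace (𝓡∂ n) (x z)) (y : EuclideanSpace ℝ (Fin m)) : ExtForms m :=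
  (1 / (((n - 2)‼ : ℝ) * sphereVolume n)) •
    ∑ k ∈ Finset.range ((n - 1) / 2 + 1),
      ((-1 : ℝ) ^ k * (1 / ((2 : ℝ) ^ k * (k ! : ℝ) * ((n - 2 * k - 1)‼ : ℝ)))) •
        PhiK x₀ e v k y

/-! ### The forms `Φ^M(i, j)` and the coefficients `a(i, j)` -/

variable (n) in
/-- For a permutation `α` of the indices `2, …, n - 1`, the index `α_{l + 2}`. The indices
`1, …, n` are represented by `0, …, n - 1`; the value for `n - 2 ≤ l` is irrelevant. -/
def midIndex (α : Equiv.Perm (Fin (n - 2))) (l : ℕ) : Fin n :=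
  if h : l < n - 2 then ⟨(α ⟨l, h⟩ : ℕ) + 1, by have := (α ⟨l, h⟩).isLt; omega⟩ else 0

variable (n) in
/-- The last index `n` of a frame, represented by `n - 1`. -/
def lastIndex : Fin n := ⟨n - 1, Nat.sub_one_lt (NeZero.ne n)⟩

/-- The form `Φ^M(i, j) = ∑_α ε(α) ω_{1 α₂} ⋯ ω_{1 α_{n-2i-j-1}}
Ω^M_{α_{n-2i-j} α_{n-2i-j+1}} ⋯ Ω^M_{α_{n-j-2} α_{n-j-1}} ω_{α_{n-j} n} ⋯ ω_{α_{n-1} n}`, where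
`2 i + j ≤ n - 2`. -/
def PhiM (x₀ : X) (e : Fin n → ∀ z, TangentSpace (𝓡∂ n) (x z)) (i j : ℕ)
    (y : EuclideanSpace ℝ (Fin m)) : ExtForms m :=
  ∑ α : Equiv.Perm (Fin (n - 2)), ((Equiv.Perm.sign α : ℤ) : ℝ) •
    (((List.range (n - 2 * i - j - 2)).map fun l ↦
        toForm (omegaX x₀ e 0 (midIndex n α l) y)).prod
      * ((List.range i).map fun l ↦
        OmegaM x₀ e (midIndex n α (n - 2 * i - j - 2 + 2 * l))
          (midIndex n α (n - 2 * i - j - 2 + 2 * l + 1)) y).prod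
      * ((List.range j).map fun l ↦
        toForm (omegaX x₀ e (midIndex n α (n - j - 2 + l)) (lastIndex n) y)).prod)

end Manifold

/-- The function `T(p, q)(φ) = cos^p φ sin^q φ`. -/
def trigT (p q : ℕ) (t : ℝ) : ℝ := Real.cos t ^ p * Real.sin t ^ q

/-- The coefficient `a(i, j)(φ)`; the sum runs over `i ≤ k ≤ ⌊(n - j) / 2⌋ - 1`. -/
def aCoeff (n i j : ℕ) (t : ℝ) : ℝ :=
  ∑ k ∈ Finset.Ico i ((n - j) / 2),
    (-1 : ℝ) ^ (n + j + k) *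
      (((n - 2 * k - 2)‼ : ℝ) /
        ((2 : ℝ) ^ k * (j ! : ℝ) * ((n - 2 * k - j - 2)! : ℝ) * (i ! : ℝ) * ((k - i)! : ℝ))) *
      trigT (n - 2 * k - j - 2) j t

/-- The region `D₁` of all pairs `(i, j)` of nonnegative integers with `2 i + j ≤ n - 2`. -/
def regionD1 (n : ℕ) : Finset (ℕ × ℕ) :=
  (Finset.range (n - 1) ×ˢ Finset.range (n - 1)).filter fun ij ↦ 2 * ij.1 + ij.2 ≤ n - 2

end

/-!
Signed sums over permutations such as `Φ_k` and `Φ^M(i, j)` are treated as Berezin integrals. Let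
`η_1, …, η_n` be anticommuting variables that commute with differential forms. Then `Φ_k` is the
coefficient of `η_1 ⋯ η_n` in `u θ^(n-2k-1) Ω^k`, where `u = ∑ u_A η_A`, `θ = ∑ θ_A η_A` and
`Ω = ∑ Ω_AB η_A η_B` (`PhiK_eq_berezin`), and `Φ^M(i, j)` is a similar coefficient in the variables
`η_2, …, η_(n-1)` (`PhiM_eq_berezin`). Elements such as `θ` and `Ω` are even, so that they can be
manipulated almost as in a commutative ring.

A change of the orthonormal frame by `R` acts on `u`, `θ` and `Ω` as the linear substitution `R` of
the variables, which multiplies the coefficient of `η_1 ⋯ η_n` by `det R = 1`. Therefore `Φ` can be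
computed in the adapted frame (`PhiK_eq_of_frames`). There `u = cos φ η_1 + sin φ η_n`, since
`v = cos φ e_1 + sin φ e_n`. Along `∂/∂φ` neither the base point nor `p(v) = e_n` moves, and
`e_2, …, e_n` stay tangent to `M`. Hence the contraction with `∂/∂φ` annihilates the curvature forms
(`IsAdaptedFrame.contraction_OmegaX`) and the forms `ω_1A`, `ω_nA`
(`IsAdaptedFrame.omegaX_apply_eq_zero`), and it maps `θ` to `-sin φ η_1 + cos φ η_n`. The product of
the latter with `u` is `(cos² φ + sin² φ) η_1 η_n = η_1 η_n`. So the contraction of `Φ_k` is, up to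
the factor `(-1)^n (n-2k-1)`, the Berezin integral of `θ^(n-2k-2) Ω^k` in the variables
`η_2, …, η_(n-1)` only (`contraction_berezin`).

In these variables `θ_s = cos φ ω_1s - sin φ ω_sn`, and the Gauss equation
`Ω_st = Ω^M_st + ω_1s ω_1t` (`IsAdaptedFrame.OmegaX_eq_OmegaM_add`) says that
`Ω = Ω^M + (∑ ω_1s η_s)²`. As all these elements commute, two binomial expansions
(`oddSum_pow_mul_evenSum_pow`) give the coefficients `a(i, j)`.

Connection forms are computed in a chart, as `⟨∇_ξ a, b⟩` for the pullback of the Levi-Civita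
connection to an open subset of `ℝᵐ`. The outward normal is defined by means of another chart at
each point, but a change of charts preserves the hyperplane of vectors tangent to the boundary
(`chartVec_self_apply_zero`).
-/

open scoped TensorProduct

noncomputable section

/-! ### Words in anticommuting frame variables -/

/-- A product of `p` factors depends only on the first `p` indices. -/
theorem oddWord_congr {A : Type*} [Monoid A] {I : Type*} (θ : I → A) (p : ℕ) (s s' : ℕ → I)
    (h : ∀ l < p, s l = s' l) :
    ((List.range p).map fun l ↦ θ (s l)).prod = ((List.range p).map fun l ↦ θ (s' l)).prod := by
  congr 1
  exact List.map_congr_left fun l hl ↦ by rw [h l (List.mem_range.1 hl)]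

theorem evenWord_congr {A : Type*} [Monoid A] {I : Type*} (Ω : I → I → A) (k : ℕ) (s s' : ℕ → I)
    (h : ∀ l < 2 * k, s l = s' l) :
    ((List.range k).map fun l ↦ Ω (s (2 * l)) (s (2 * l + 1))).prod =
      ((List.range k).map fun l ↦ Ω (s' (2 * l)) (s' (2 * l + 1))).prod := by
  congr 1
  refine List.map_congr_left fun l hl ↦ ?_
  have := List.mem_range.1 hl
  rw [h _ (by omega), h _ (by omega)]

section Words

variable {A : Type*} [Ring A] [Algebra ℝ A] {n : ℕ}

/-- The algebra of polynomials with coefficients in `A` in anticommuting variables `η_1, …, η_n`.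
The tensor product is the ungraded one: the variables commute with `A`, also when `A` is an exterior
algebra. Therefore a sum `∑_A θ_A η_A` with one-forms `θ_A` is even, and such sums commute. -/
abbrev FrameAlg (A : Type*) [Ring A] [Algebra ℝ A] (n : ℕ) : Type _ :=
  A ⊗[ℝ] ExteriorAlgebra ℝ (Fin n → ℝ)

/-- The anticommuting variable `η_i`. -/
def frameVar (i : Fin n) : ExteriorAlgebra ℝ (Fin n → ℝ) :=
  ExteriorAlgebra.ι ℝ (Pi.single i 1)

/-- The coefficient of `η_1 ⋯ η_n`: the determinant in degree `n`, and zero in the other degrees. -/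
def topCoeff (n : ℕ) : ExteriorAlgebra ℝ (Fin n → ℝ) →ₗ[ℝ] ℝ :=
  ExteriorAlgebra.liftAlternating (R := ℝ)
    (Function.update (0 : ∀ i, (Fin n → ℝ) [⋀^Fin i]→ₗ[ℝ] ℝ) n Matrix.detRowAlternating)

/-- The Berezin integral, which takes the coefficient of `η_1 ⋯ η_n`. -/
def berezin (A : Type*) [Ring A] [Algebra ℝ A] (n : ℕ) : FrameAlg A n →ₗ[ℝ] A :=
  (TensorProduct.rid ℝ A).toLinearMap ∘ₗ LinearMap.lTensor A (topCoeff n)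

theorem berezin_tmul (a : A) (b : ExteriorAlgebra ℝ (Fin n → ℝ)) :
    berezin A n (a ⊗ₜ b) = topCoeff n b • a := by
  simp [berezin]

theorem topCoeff_ιMulti (v : Fin n → Fin n → ℝ) :
    topCoeff n (ExteriorAlgebra.ιMulti ℝ n v) = (Matrix.of v).det := by
  rw [topCoeff, ExteriorAlgebra.liftAlternating_apply_ιMulti]
  simp; rfl

theorem topCoeff_ιMulti_of_ne {i : ℕ} (h : i ≠ n) (v : Fin i → Fin n → ℝ) :
    topCoeff n (ExteriorAlgebra.ιMulti ℝ i v) = 0 := by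
  rw [topCoeff, ExteriorAlgebra.liftAlternating_apply_ιMulti]
  simp [Function.update_of_ne h]

theorem topCoeff_ιMulti_single (σ : Fin n → Fin n) :
    topCoeff n (ExteriorAlgebra.ιMulti ℝ n fun l ↦ Pi.single (σ l) 1) =
      if h : Function.Bijective σ then
        ((Equiv.Perm.sign (Equiv.ofBijective σ h) : ℤ) : ℝ) else 0 := by
  rw [topCoeff_ιMulti]
  split_ifs with h
  · rw [← Matrix.det_permutation]
    refine congrArg Matrix.det (Matrix.ext fun i j ↦ ?_)
    change (Pi.single (σ i) 1 : Fin n → ℝ) j = _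
    simp [Pi.single_apply, Equiv.Perm.permMatrix, PEquiv.toMatrix, eq_comm]
  · have : ¬ Function.Injective σ := fun hi ↦ h (Finite.injective_iff_bijective.1 hi)
    simp only [Function.Injective, not_forall] at this
    obtain ⟨i, j, hij, hne⟩ := this
    exact Matrix.det_zero_of_row_eq hne (congrArg (fun a ↦ (Pi.single a 1 : Fin n → ℝ)) hij)

variable [NeZero n]

/-- The extension of a finite sequence of indices to an infinite one. -/
def seqExt {q : ℕ} (σ : Fin q → Fin n) (l : ℕ) : Fin n :=
  if h : l < q then σ ⟨l, h⟩ else 0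

/-- The sum of `F(s) η_{s 0} ⋯ η_{s (q-1)}` over all sequences of `q` indices. -/
def wordSum (q : ℕ) (F : (ℕ → Fin n) → A) : FrameAlg A n :=
  ∑ σ : Fin q → Fin n, F (seqExt σ) ⊗ₜ ExteriorAlgebra.ιMulti ℝ q fun l ↦ Pi.single (σ l) 1

/-- Sums of words are multiplied by concatenation, provided that the coefficients depend only on
the indices that occur in the word. -/
theorem wordSum_mul_wordSum {q r : ℕ} {F G : (ℕ → Fin n) → A}
    (hF : ∀ s s' : ℕ → Fin n, (∀ l < q, s l = s' l) → F s = F s')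
    (hG : ∀ s s' : ℕ → Fin n, (∀ l < r, s l = s' l) → G s = G s') :
    wordSum q F * wordSum r G = wordSum (q + r) fun s ↦ F s * G fun l ↦ s (q + l) := by
  simp only [wordSum]
  rw [Finset.sum_mul_sum, ← Fintype.sum_prod_type']
  refine Fintype.sum_equiv (Fin.appendEquiv q r) _ _ fun x ↦ ?_
  obtain ⟨σ, τ⟩ := x
  simp only [Algebra.TensorProduct.tmul_mul_tmul, ExteriorAlgebra.ιMulti_mul_ιMulti]
  have h1 : F (seqExt (Fin.append σ τ)) = F (seqExt σ) := by
    refine hF _ _ fun l hl ↦ ?_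
    have hl' : l < q + r := by omega
    simp only [seqExt, hl, hl', dif_pos]
    exact Fin.append_left σ τ ⟨l, hl⟩
  have h2 : G (fun l ↦ seqExt (Fin.append σ τ) (q + l)) = G (seqExt τ) := by
    refine hG _ _ fun l hl ↦ ?_
    have hl' : q + l < q + r := by omega
    simp only [seqExt, hl, hl', dif_pos]
    exact Fin.append_right σ τ ⟨l, hl⟩
  have h3 : (Fin.append (fun l ↦ (Pi.single (σ l) 1 : Fin n → ℝ)) fun l ↦ Pi.single (τ l) 1) =
      fun l ↦ Pi.single (Fin.append σ τ l) 1 := by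
    ext1 l
    refine Fin.addCases (fun i ↦ ?_) (fun i ↦ ?_) l <;> simp
  simp only [Fin.appendEquiv, Equiv.coe_fn_mk, h1, h2, h3]

/-- The Berezin integral of a sum of words of length `n` is a signed sum over the permutations. -/
theorem berezin_wordSum {q : ℕ} (hq : q = n) (F : (ℕ → Fin n) → A) :
    berezin A n (wordSum q F) =
      ∑ σ : Equiv.Perm (Fin n), ((Equiv.Perm.sign σ : ℤ) : ℝ) • F (seqExt σ) := by
  subst q
  rw [wordSum, map_sum]
  symm
  refine Fintype.sum_of_injective (fun σ : Equiv.Perm (Fin n) ↦ (σ : Fin n → Fin n))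
    DFunLike.coe_injective _ _ (fun τ hτ ↦ ?_) fun σ ↦ ?_
  · rw [berezin_tmul, topCoeff_ιMulti_single, dif_neg, zero_smul]
    exact fun h ↦ hτ ⟨Equiv.ofBijective τ h, rfl⟩
  · rw [berezin_tmul, topCoeff_ιMulti_single, dif_pos σ.bijective]
    congr 4
    ext; rfl

end Words

/-! ### Sums of one-forms and of two-forms over a frame -/

section FrameSums

variable {A : Type*} [Ring A] [Algebra ℝ A] {n : ℕ}

/-- The element `∑_A θ_A η_A`. -/
def oddSum (θ : Fin n → A) : FrameAlg A n := ∑ i, θ i ⊗ₜ frameVar i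

/-- The element `∑_{A, B} Ω_AB η_A η_B`. -/
def evenSum (Ω : Fin n → Fin n → A) : FrameAlg A n :=
  ∑ i, ∑ j, Ω i j ⊗ₜ (frameVar i * frameVar j)

theorem tmul_ι_eq_oddSum (u : Fin n → ℝ) :
    (1 : A) ⊗ₜ[ℝ] ExteriorAlgebra.ι ℝ u = oddSum fun i ↦ algebraMap ℝ A (u i) := by
  have hu : u = ∑ i, u i • (Pi.single i 1 : Fin n → ℝ) := by
    simpa using (pi_eq_sum_univ' u)
  conv_lhs => rw [hu]
  simp only [oddSum, frameVar, map_sum, map_smul, TensorProduct.tmul_sum,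
    Algebra.algebraMap_eq_smul_one, TensorProduct.tmul_smul, TensorProduct.smul_tmul']

section

variable [NeZero n]

theorem oddSum_eq_wordSum (θ : Fin n → A) : oddSum θ = wordSum 1 fun s ↦ θ (s 0) := by
  rw [oddSum, wordSum]
  refine Fintype.sum_equiv (Equiv.funUnique (Fin 1) (Fin n)).symm _ _ fun i ↦ ?_
  simp [seqExt, ExteriorAlgebra.ιMulti_apply, frameVar]

theorem evenSum_eq_wordSum (Ω : Fin n → Fin n → A) :
    evenSum Ω = wordSum 2 fun s ↦ Ω (s 0) (s 1) := by
  rw [evenSum, wordSum, ← Fintype.sum_prod_type']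
  refine Fintype.sum_equiv (finTwoArrowEquiv (Fin n)).symm _ _ fun i ↦ ?_
  simp [seqExt, ExteriorAlgebra.ιMulti_apply, frameVar]
  rfl

theorem one_eq_wordSum : (1 : FrameAlg A n) = wordSum 0 fun _ ↦ 1 := by
  simp [wordSum, Algebra.TensorProduct.one_def]

theorem oddSum_pow (θ : Fin n → A) (p : ℕ) :
    oddSum θ ^ p = wordSum p fun s ↦ ((List.range p).map fun l ↦ θ (s l)).prod := by
  induction p with
  | zero => simpa using one_eq_wordSum
  | succ p ih =>
    rw [pow_succ, ih, oddSum_eq_wordSum, wordSum_mul_wordSum]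
    · simp [List.range_succ]
    · exact oddWord_congr θ p
    · intro s s' h
      rw [h 0 one_pos]

theorem evenSum_pow (Ω : Fin n → Fin n → A) (k : ℕ) :
    evenSum Ω ^ k = wordSum (2 * k) fun s ↦
      ((List.range k).map fun l ↦ Ω (s (2 * l)) (s (2 * l + 1))).prod := by
  induction k with
  | zero => simpa using one_eq_wordSum
  | succ k ih =>
    rw [pow_succ, ih, evenSum_eq_wordSum, wordSum_mul_wordSum]
    · simp [List.range_succ, mul_add]
    · exact evenWord_congr Ω k
    · intro s s' h
      rw [h 0 two_pos, h 1 one_lt_two]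

/-- The Berezin integral that produces the signed sums `Φ_k`. -/
theorem berezin_odd_odd_even (u : Fin n → ℝ) (θ : Fin n → A) (Ω : Fin n → Fin n → A) {p k : ℕ}
    (hpk : 1 + p + 2 * k = n) :
    berezin A n ((1 ⊗ₜ ExteriorAlgebra.ι ℝ u) * oddSum θ ^ p * evenSum Ω ^ k) =
      ∑ σ : Equiv.Perm (Fin n), (((Equiv.Perm.sign σ : ℤ) : ℝ) * u (σ 0)) •
        (((List.range p).map fun l ↦ θ (σ (Fin.ofNat n (l + 1)))).prod *
          ((List.range k).map fun l ↦ Ω (σ (Fin.ofNat n (p + 1 + 2 * l)))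
            (σ (Fin.ofNat n (p + 1 + 2 * l + 1)))).prod) := by
  have hext (σ : Equiv.Perm (Fin n)) (l : ℕ) (hl : l < n) : seqExt σ l = σ (Fin.ofNat n l) := by
    rw [seqExt, dif_pos hl]
    congr 1
    ext
    simp [Nat.mod_eq_of_lt hl]
  rw [tmul_ι_eq_oddSum, oddSum_pow, evenSum_pow, oddSum_eq_wordSum, wordSum_mul_wordSum,
    wordSum_mul_wordSum, berezin_wordSum hpk]
  · refine Finset.sum_congr rfl fun σ _ ↦ ?_
    rw [mul_smul, hext σ 0 (by omega), mul_assoc, ← Algebra.smul_def]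
    congr 4
    · refine List.map_congr_left fun l hl ↦ ?_
      have := List.mem_range.1 hl
      rw [← add_comm 1 l, ← hext σ (1 + l) (by omega)]
    · refine List.map_congr_left fun l hl ↦ ?_
      have := List.mem_range.1 hl
      rw [← hext σ (p + 1 + 2 * l) (by omega), ← hext σ (p + 1 + 2 * l + 1) (by omega),
        add_comm p 1, add_assoc (1 + p)]
  · intro s s' h
    rw [h 0 (by omega)]
    congr 2
    exact List.map_congr_left fun l hl ↦ congrArg θ
      (h (1 + l) (by have := List.mem_range.1 hl; omega))
  · exact evenWord_congr Ω k
  · intro s s' h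
    rw [h 0 one_pos]
  · exact oddWord_congr θ p

/-- The Berezin integral that produces the signed sums `Φ^M(i, j)`. -/
theorem berezin_odd_even_odd (χ ψ : Fin n → A) (Ω : Fin n → Fin n → A) {a i j : ℕ}
    (h : a + 2 * i + j = n) :
    berezin A n (oddSum χ ^ a * evenSum Ω ^ i * oddSum ψ ^ j) =
      ∑ σ : Equiv.Perm (Fin n), ((Equiv.Perm.sign σ : ℤ) : ℝ) •
        (((List.range a).map fun l ↦ χ (seqExt σ l)).prod *
          ((List.range i).map fun l ↦
            Ω (seqExt σ (a + 2 * l)) (seqExt σ (a + 2 * l + 1))).prod *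
          ((List.range j).map fun l ↦ ψ (seqExt σ (a + 2 * i + l))).prod) := by
  rw [oddSum_pow, evenSum_pow, oddSum_pow, wordSum_mul_wordSum (oddWord_congr χ a)
    (evenWord_congr Ω i), wordSum_mul_wordSum _ (oddWord_congr ψ j), berezin_wordSum h]
  · simp only [add_assoc]
  · intro s s' h
    rw [oddWord_congr χ a s s' fun l hl ↦ h l (by omega),
      evenWord_congr Ω i (fun l ↦ s (a + l)) (fun l ↦ s' (a + l)) fun l hl ↦ h _ (by omega)]

end

end FrameSums

/-! ### Change of frame, contraction and commutation -/

section FrameChange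

variable {A : Type*} [Ring A] [Algebra ℝ A] {n : ℕ}

/-- The substitution `η_B ↦ ∑_A R_AB η_A` of the frame variables. -/
def substFrame (A : Type*) [Ring A] [Algebra ℝ A] {m n : ℕ} (R : Matrix (Fin n) (Fin m) ℝ) :
    FrameAlg A m →ₐ[ℝ] FrameAlg A n :=
  Algebra.TensorProduct.map (AlgHom.id ℝ A) (ExteriorAlgebra.map R.mulVecLin)

theorem substFrame_tmul_frameVar {m : ℕ} (R : Matrix (Fin n) (Fin m) ℝ) (a : A) (j : Fin m) :
    substFrame A R (a ⊗ₜ frameVar j) = ∑ i, (R i j • a) ⊗ₜ frameVar i := by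
  have h : R.mulVecLin (Pi.single j 1) = ∑ i, R i j • (Pi.single i 1 : Fin n → ℝ) := by
    rw [Matrix.mulVecLin_apply, Matrix.mulVec_single_one]
    simpa using (pi_eq_sum_univ' (R.col j))
  simp only [substFrame, frameVar, Algebra.TensorProduct.map_tmul, ExteriorAlgebra.map_apply_ι, h,
    map_sum, map_smul, TensorProduct.tmul_sum, TensorProduct.tmul_smul, TensorProduct.smul_tmul',
    AlgHom.id_apply]

theorem substFrame_oddSum {m : ℕ} (R : Matrix (Fin n) (Fin m) ℝ) (θ : Fin m → A) :
    substFrame A R (oddSum θ) = oddSum fun i ↦ ∑ j, R i j • θ j := by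
  simp only [oddSum, map_sum, substFrame_tmul_frameVar, TensorProduct.sum_tmul]
  exact Finset.sum_comm

theorem substFrame_tmul_frameVar_mul {m : ℕ} (R : Matrix (Fin n) (Fin m) ℝ) (a : A)
    (k l : Fin m) :
    substFrame A R (a ⊗ₜ (frameVar k * frameVar l)) =
      ∑ i, ∑ j, ((R i k * R j l) • a) ⊗ₜ (frameVar i * frameVar j) := by
  have h : a ⊗ₜ[ℝ] (frameVar k * frameVar l) =
      (a ⊗ₜ[ℝ] frameVar k) * ((1 : A) ⊗ₜ frameVar l) := by simp
  rw [h, map_mul, substFrame_tmul_frameVar, substFrame_tmul_frameVar, Finset.sum_mul_sum]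
  simp only [Algebra.TensorProduct.tmul_mul_tmul, smul_mul_smul_comm, mul_one]

theorem substFrame_evenSum {m : ℕ} (R : Matrix (Fin n) (Fin m) ℝ) (Ω : Fin m → Fin m → A) :
    substFrame A R (evenSum Ω) =
      evenSum fun i j ↦ ∑ k, ∑ l, (R i k * R j l) • Ω k l := by
  simp only [evenSum, map_sum, substFrame_tmul_frameVar_mul, TensorProduct.sum_tmul]
  calc _ = ∑ k, ∑ i, ∑ l, ∑ j, ((R i k * R j l) • Ω k l) ⊗ₜ[ℝ] (frameVar i * frameVar j) :=
        Finset.sum_congr rfl fun k _ ↦ Finset.sum_comm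
    _ = ∑ i, ∑ k, ∑ j, ∑ l, ((R i k * R j l) • Ω k l) ⊗ₜ[ℝ] (frameVar i * frameVar j) := by
        rw [Finset.sum_comm]
        exact Finset.sum_congr rfl fun i _ ↦ Finset.sum_congr rfl fun k _ ↦ Finset.sum_comm
    _ = _ := Finset.sum_congr rfl fun i _ ↦ Finset.sum_comm

theorem substFrame_tmul_ι {m : ℕ} (R : Matrix (Fin n) (Fin m) ℝ) (a : A) (u : Fin m → ℝ) :
    substFrame A R (a ⊗ₜ ExteriorAlgebra.ι ℝ u) = a ⊗ₜ ExteriorAlgebra.ι ℝ (R.mulVec u) := by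
  simp [substFrame]

theorem topCoeff_map (R : Matrix (Fin n) (Fin n) ℝ) :
    topCoeff n ∘ₗ (ExteriorAlgebra.map R.mulVecLin).toLinearMap = R.det • topCoeff n := by
  refine ExteriorAlgebra.lhom_ext fun i ↦ ?_
  ext v
  simp only [LinearMap.compAlternatingMap_apply, LinearMap.comp_apply, AlgHom.toLinearMap_apply,
    ExteriorAlgebra.map_apply_ιMulti, LinearMap.smul_apply]
  by_cases hi : i = n
  · subst hi
    rw [topCoeff_ιMulti, topCoeff_ιMulti, smul_eq_mul, mul_comm, ← Matrix.det_transpose R,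
      ← Matrix.det_mul]
    congr 1
    ext a b
    simp [Matrix.mul_apply, Matrix.mulVec, dotProduct, mul_comm]
  · rw [topCoeff_ιMulti_of_ne hi, topCoeff_ιMulti_of_ne hi, smul_zero]

/-- The Berezin integral transforms with the determinant under a linear change of variables. -/
theorem berezin_substFrame (R : Matrix (Fin n) (Fin n) ℝ) (Z : FrameAlg A n) :
    berezin A n (substFrame A R Z) = R.det • berezin A n Z := by
  induction Z using TensorProduct.induction_on with
  | zero => simp
  | tmul a b =>
    have h := LinearMap.congr_fun (topCoeff_map R) b
    simp only [LinearMap.comp_apply, AlgHom.toLinearMap_apply, LinearMap.smul_apply,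
      smul_eq_mul] at h
    simp [substFrame, berezin_tmul, h, mul_smul]
  | add x y hx hy => rw [map_add, map_add, hx, hy, map_add, smul_add]

end FrameChange

theorem ι_mul_ι_swap {R M : Type*} [CommRing R] [AddCommGroup M] [Module R M] (x y : M) :
    ExteriorAlgebra.ι R x * ExteriorAlgebra.ι R y =
      -(ExteriorAlgebra.ι R y * ExteriorAlgebra.ι R x) :=
  eq_neg_of_add_eq_zero_left (ExteriorAlgebra.ι_add_mul_swap x y)

section Contraction

variable {M : Type*} [AddCommGroup M] [Module ℝ M] {n : ℕ}

/-- The contraction of an exterior form with the vector `δ` of the bidual. -/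
def contraction (δ : Module.Dual ℝ M) : ExteriorAlgebra ℝ M →ₗ[ℝ] ExteriorAlgebra ℝ M :=
  CliffordAlgebra.contractLeft δ

theorem contraction_ι_mul (δ : Module.Dual ℝ M) (a : M) (b : ExteriorAlgebra ℝ M) :
    contraction δ (ExteriorAlgebra.ι ℝ a * b) =
      δ a • b - ExteriorAlgebra.ι ℝ a * contraction δ b :=
  CliffordAlgebra.contractLeft_ι_mul _ _ _

theorem contraction_one (δ : Module.Dual ℝ M) : contraction δ 1 = 0 :=
  CliffordAlgebra.contractLeft_one _ _

/-- The contraction, extended to forms with frame variables. -/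
def frameContraction (n : ℕ) (δ : Module.Dual ℝ M) :
    FrameAlg (ExteriorAlgebra ℝ M) n →ₗ[ℝ] FrameAlg (ExteriorAlgebra ℝ M) n :=
  LinearMap.rTensor _ (contraction δ)

theorem berezin_frameContraction (δ : Module.Dual ℝ M) (Z : FrameAlg (ExteriorAlgebra ℝ M) n) :
    berezin _ n (frameContraction n δ Z) = contraction δ (berezin _ n Z) := by
  induction Z using TensorProduct.induction_on with
  | zero => simp
  | tmul a b => simp [frameContraction, berezin_tmul]
  | add x y hx hy => simp only [map_add, hx, hy]

theorem frameContraction_tmul_mul (δ : Module.Dual ℝ M) (b : ExteriorAlgebra ℝ (Fin n → ℝ))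
    (Z : FrameAlg (ExteriorAlgebra ℝ M) n) :
    frameContraction n δ ((1 ⊗ₜ b) * Z) = (1 ⊗ₜ b) * frameContraction n δ Z := by
  induction Z using TensorProduct.induction_on with
  | zero => simp
  | tmul a b => simp [frameContraction]
  | add x y hx hy => simp only [map_add, mul_add, hx, hy]

theorem frameContraction_oddSum_mul (δ : Module.Dual ℝ M) (θ : Fin n → M)
    (Z : FrameAlg (ExteriorAlgebra ℝ M) n) :
    frameContraction n δ (oddSum (fun i ↦ ExteriorAlgebra.ι ℝ (θ i)) * Z) =
      (1 ⊗ₜ ExteriorAlgebra.ι ℝ fun i ↦ δ (θ i)) * Z -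
        oddSum (fun i ↦ ExteriorAlgebra.ι ℝ (θ i)) * frameContraction n δ Z := by
  induction Z using TensorProduct.induction_on with
  | zero => simp
  | tmul a b =>
    rw [tmul_ι_eq_oddSum]
    simp only [oddSum, Finset.sum_mul, map_sum, ← Finset.sum_sub_distrib]
    refine Finset.sum_congr rfl fun i _ ↦ ?_
    simp [frameContraction, contraction_ι_mul, TensorProduct.sub_tmul, Algebra.smul_def]
  | add x y hx hy => simp only [map_add, mul_add, hx, hy]; abel

theorem frameContraction_evenSum_mul (δ : Module.Dual ℝ M)
    {Ω : Fin n → Fin n → ExteriorAlgebra ℝ M}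
    (hΩ : ∀ i j b, contraction δ (Ω i j * b) = Ω i j * contraction δ b)
    (Z : FrameAlg (ExteriorAlgebra ℝ M) n) :
    frameContraction n δ (evenSum Ω * Z) = evenSum Ω * frameContraction n δ Z := by
  induction Z using TensorProduct.induction_on with
  | zero => simp
  | tmul a b =>
    simp only [evenSum, Finset.sum_mul, map_sum]
    refine Finset.sum_congr rfl fun i _ ↦ Finset.sum_congr rfl fun j _ ↦ ?_
    simp [frameContraction, hΩ]
  | add x y hx hy => simp only [map_add, mul_add, hx, hy]

theorem frameContraction_evenSum_pow (δ : Module.Dual ℝ M)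
    {Ω : Fin n → Fin n → ExteriorAlgebra ℝ M}
    (hΩ : ∀ i j b, contraction δ (Ω i j * b) = Ω i j * contraction δ b) (k : ℕ) :
    frameContraction n δ (evenSum Ω ^ k) = 0 := by
  induction k with
  | zero => simp [frameContraction, Algebra.TensorProduct.one_def, contraction_one]
  | succ k ih => rw [pow_succ', frameContraction_evenSum_mul δ hΩ, ih, mul_zero]

theorem oddSum_mul_tmul_ι {A : Type*} [Ring A] [Algebra ℝ A] (θ : Fin n → A) (u : Fin n → ℝ) :
    oddSum θ * (1 ⊗ₜ ExteriorAlgebra.ι ℝ u) = -((1 ⊗ₜ ExteriorAlgebra.ι ℝ u) * oddSum θ) := by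
  simp only [oddSum, Finset.sum_mul, Finset.mul_sum, ← Finset.sum_neg_distrib]
  refine Finset.sum_congr rfl fun i _ ↦ ?_
  simp only [Algebra.TensorProduct.tmul_mul_tmul, one_mul, mul_one, frameVar]
  rw [ι_mul_ι_swap, TensorProduct.tmul_neg]

/-- The contraction of the power of an odd sum. The contraction changes sign when it passes a
one-form, and so does `∑_A δ(θ_A) η_A` when it passes a frame variable; the two signs cancel, and
the `p` factors contribute equally, as for a derivation. -/
theorem frameContraction_oddSum_pow_mul (δ : Module.Dual ℝ M) (θ : Fin n → M)
    {Z : FrameAlg (ExteriorAlgebra ℝ M) n} (hZ : frameContraction n δ Z = 0) (p : ℕ) :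
    frameContraction n δ (oddSum (fun i ↦ ExteriorAlgebra.ι ℝ (θ i)) ^ p * Z) =
      (p : ℝ) • ((1 ⊗ₜ ExteriorAlgebra.ι ℝ fun i ↦ δ (θ i)) *
        (oddSum (fun i ↦ ExteriorAlgebra.ι ℝ (θ i)) ^ (p - 1) * Z)) := by
  induction p with
  | zero => simpa using hZ
  | succ p ih =>
    rw [pow_succ', mul_assoc, frameContraction_oddSum_mul, ih]
    rcases p with _ | p
    · simp
    · simp only [Nat.add_sub_cancel]
      rw [mul_smul_comm, ← mul_assoc (oddSum _), oddSum_mul_tmul_ι, pow_succ' _ p]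
      simp only [neg_mul, mul_assoc, smul_neg, sub_neg_eq_add]
      push_cast
      module

end Contraction

section Commutation

variable {M : Type*} [AddCommGroup M] [Module ℝ M] {n : ℕ}

theorem commute_ι_mul_ι (x y : M) (b : ExteriorAlgebra ℝ M) :
    Commute (ExteriorAlgebra.ι ℝ x * ExteriorAlgebra.ι ℝ y) b := by
  induction b using ExteriorAlgebra.induction with
  | algebraMap r => exact (Algebra.commutes r _).symm
  | ι z =>
    change _ = _
    rw [mul_assoc, ι_mul_ι_swap y z, mul_neg, ← mul_assoc, ι_mul_ι_swap x z, neg_mul, neg_neg,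
      mul_assoc]
  | mul a b ha hb => exact ha.mul_right hb
  | add a b ha hb => exact ha.add_right hb

theorem commute_evenSum {Ω : Fin n → Fin n → ExteriorAlgebra ℝ M}
    (hΩ : ∀ i j b, Commute (Ω i j) b) (Z : FrameAlg (ExteriorAlgebra ℝ M) n) :
    Commute (evenSum Ω) Z := by
  induction Z using TensorProduct.induction_on with
  | zero => exact Commute.zero_right _
  | tmul a b =>
    refine Commute.sum_left _ _ _ fun i _ ↦ Commute.sum_left _ _ _ fun j _ ↦ ?_
    change _ = _
    rw [Algebra.TensorProduct.tmul_mul_tmul, Algebra.TensorProduct.tmul_mul_tmul, (hΩ i j a).eq,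
      frameVar, frameVar, (commute_ι_mul_ι _ _ b).eq]
  | add x y hx hy => exact hx.add_right hy

/-- Two signs cancel: one from the one-forms, one from the frame variables. -/
theorem commute_oddSum (θ χ : Fin n → M) :
    Commute (oddSum fun i ↦ ExteriorAlgebra.ι ℝ (θ i))
      (oddSum fun i ↦ ExteriorAlgebra.ι ℝ (χ i)) := by
  refine Commute.sum_left _ _ _ fun i _ ↦ Commute.sum_right _ _ _ fun j _ ↦ ?_
  change _ = _
  rw [Algebra.TensorProduct.tmul_mul_tmul, Algebra.TensorProduct.tmul_mul_tmul, ι_mul_ι_swap,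
    frameVar, frameVar, ι_mul_ι_swap (Pi.single i 1), TensorProduct.neg_tmul,
    TensorProduct.tmul_neg, neg_neg]

theorem oddSum_mul_self (θ : Fin n → M) :
    (oddSum fun i ↦ ExteriorAlgebra.ι ℝ (θ i)) ^ 2 =
      evenSum fun i j ↦ ExteriorAlgebra.ι ℝ (θ i) * ExteriorAlgebra.ι ℝ (θ j) := by
  simp only [sq, oddSum, evenSum, Finset.sum_mul_sum, Algebra.TensorProduct.tmul_mul_tmul]

end Commutation

/-! ### Contraction in an adapted frame -/

section FirstLast

variable {A : Type*} [Ring A] [Algebra ℝ A] {n : ℕ}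

/-- The inclusion of the indices that are neither the first nor the last one. -/
def midEmb (n : ℕ) (s : Fin (n - 2)) : Fin n := ⟨s + 1, by omega⟩

theorem midEmb_injective : Function.Injective (midEmb n) := fun s t h ↦ by
  simpa [midEmb, Fin.ext_iff] using h

/-- The inclusion of the variables with intermediate indices into all frame variables. -/
def midMatrix (n : ℕ) : Matrix (Fin n) (Fin (n - 2)) ℝ :=
  Matrix.of fun i s ↦ if i = midEmb n s then 1 else 0

theorem midMatrix_mulVecLin_single (s : Fin (n - 2)) :
    (midMatrix n).mulVecLin (Pi.single s 1) = Pi.single (midEmb n s) 1 := by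
  rw [Matrix.mulVecLin_apply, Matrix.mulVec_single_one]
  ext i
  simp [midMatrix, Pi.single_apply]

theorem map_midMatrix_frameVar (s : Fin (n - 2)) :
    ExteriorAlgebra.map (midMatrix n).mulVecLin (frameVar s) = frameVar (midEmb n s) := by
  rw [frameVar, ExteriorAlgebra.map_apply_ι, midMatrix_mulVecLin_single, frameVar]

variable [NeZero n]

theorem exists_midEmb_eq {i : Fin n} (h0 : i ≠ 0) (hl : i ≠ lastIndex n) :
    ∃ s, midEmb n s = i := by
  have h0' : (i : ℕ) ≠ 0 := fun h ↦ h0 (Fin.ext h)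
  have hl' : (i : ℕ) ≠ n - 1 := fun h ↦ hl (Fin.ext h)
  exact ⟨⟨i - 1, by have := i.isLt; omega⟩, Fin.ext (by simp only [midEmb]; omega)⟩

theorem zero_ne_lastIndex (hn : 2 ≤ n) : (0 : Fin n) ≠ lastIndex n := fun h ↦ by
  have := congrArg Fin.val h
  simp [lastIndex] at this
  omega

theorem midEmb_ne_zero (s : Fin (n - 2)) : midEmb n s ≠ 0 := fun h ↦ by
  simpa [midEmb] using congrArg Fin.val h

theorem midEmb_ne_lastIndex (s : Fin (n - 2)) : midEmb n s ≠ lastIndex n := fun h ↦ by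
  have := congrArg Fin.val h
  simp only [midEmb, lastIndex] at this
  omega

/-- The product `η_1 η_n` of the first and the last frame variable. -/
def firstLast (A : Type*) [Ring A] [Algebra ℝ A] (n : ℕ) [NeZero n] : FrameAlg A n :=
  1 ⊗ₜ (frameVar 0 * frameVar (lastIndex n))

theorem commute_firstLast (Z : FrameAlg A n) : Commute (firstLast A n) Z := by
  induction Z using TensorProduct.induction_on with
  | zero => exact Commute.zero_right _
  | tmul a b =>
    change _ = _
    rw [firstLast, Algebra.TensorProduct.tmul_mul_tmul, Algebra.TensorProduct.tmul_mul_tmul,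
      one_mul, mul_one, frameVar, frameVar, (commute_ι_mul_ι _ _ b).eq]
  | add x y hx hy => exact hx.add_right hy

theorem firstLast_mul_frameVar {i : Fin n} (hi : i ∉ Set.range (midEmb n)) :
    (frameVar 0 * frameVar (lastIndex n) : ExteriorAlgebra ℝ (Fin n → ℝ)) * frameVar i = 0 := by
  have h : i = 0 ∨ i = lastIndex n := by
    by_contra! h
    exact hi (exists_midEmb_eq h.1 h.2)
  rcases h with rfl | rfl
  · rw [mul_assoc, frameVar, frameVar, ι_mul_ι_swap, mul_neg, ← mul_assoc,
      ExteriorAlgebra.ι_sq_zero, zero_mul, neg_zero]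
  · rw [mul_assoc, frameVar, frameVar, ExteriorAlgebra.ι_sq_zero, mul_zero]

/-- Multiplication by `η_1 η_n` discards the first and the last term of an odd sum. -/
theorem firstLast_mul_oddSum (θ : Fin n → A) :
    firstLast A n * oddSum θ =
      firstLast A n * substFrame A (midMatrix n) (oddSum fun s ↦ θ (midEmb n s)) := by
  simp only [oddSum, map_sum, Finset.mul_sum]
  symm
  refine Fintype.sum_of_injective (midEmb n) midEmb_injective _ _ (fun i hi ↦ ?_) fun s ↦ ?_
  · rw [firstLast, Algebra.TensorProduct.tmul_mul_tmul, firstLast_mul_frameVar hi,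
      TensorProduct.tmul_zero]
  · simp [substFrame, map_midMatrix_frameVar]

theorem firstLast_mul_evenSum (Ω : Fin n → Fin n → A) :
    firstLast A n * evenSum Ω =
      firstLast A n * substFrame A (midMatrix n)
        (evenSum fun s t ↦ Ω (midEmb n s) (midEmb n t)) := by
  simp only [evenSum, map_sum, Finset.mul_sum]
  symm
  refine Fintype.sum_of_injective (midEmb n) midEmb_injective _ _ (fun i hi ↦ ?_) fun s ↦ ?_
  · refine Finset.sum_eq_zero fun j _ ↦ ?_
    rw [firstLast, Algebra.TensorProduct.tmul_mul_tmul, ← mul_assoc, firstLast_mul_frameVar hi,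
      zero_mul, TensorProduct.tmul_zero]
  refine Fintype.sum_of_injective (midEmb n) midEmb_injective _ _ (fun j hj ↦ ?_) fun t ↦ ?_
  · rw [firstLast, Algebra.TensorProduct.tmul_mul_tmul, frameVar, frameVar, frameVar, frameVar,
      ι_mul_ι_swap (Pi.single (midEmb n s) 1), mul_neg, ← mul_assoc, ← frameVar, ← frameVar,
      ← frameVar, firstLast_mul_frameVar hj, zero_mul, neg_zero, TensorProduct.tmul_zero]
  · simp [substFrame, map_midMatrix_frameVar]

theorem firstLast_mul_pow_mul_pow (θ : Fin n → A) (Ω : Fin n → Fin n → A) (p k : ℕ) :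
    firstLast A n * (oddSum θ ^ p * evenSum Ω ^ k) =
      firstLast A n * substFrame A (midMatrix n)
        (oddSum (fun s ↦ θ (midEmb n s)) ^ p *
          evenSum (fun s t ↦ Ω (midEmb n s) (midEmb n t)) ^ k) := by
  have hpow (x y : FrameAlg A n) (h : firstLast A n * x = firstLast A n * y) (q : ℕ)
      (z : FrameAlg A n) : firstLast A n * (x ^ q * z) = y ^ q * (firstLast A n * z) := by
    induction q with
    | zero => simp
    | succ q ih =>
      rw [pow_succ', mul_assoc, ← mul_assoc, h, (commute_firstLast y).eq, mul_assoc, ih,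
        pow_succ', mul_assoc]
  rw [hpow _ _ (firstLast_mul_oddSum θ), ← mul_one (evenSum Ω ^ k),
    hpow _ _ (firstLast_mul_evenSum Ω), mul_one, map_mul, map_pow, map_pow, ← mul_assoc,
    (commute_firstLast _).eq]

omit [NeZero n] in
theorem ι_mul_ιMulti {M : Type*} [AddCommGroup M] [Module ℝ M] {i : ℕ} (a : M) (v : Fin i → M) :
    ExteriorAlgebra.ι ℝ a * ExteriorAlgebra.ιMulti ℝ i v =
      (-1 : ℝ) ^ i • (ExteriorAlgebra.ιMulti ℝ i v * ExteriorAlgebra.ι ℝ a) := by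
  induction i with
  | zero => simp
  | succ i ih =>
    rw [ExteriorAlgebra.ιMulti_succ_apply, ← mul_assoc, ι_mul_ι_swap, neg_mul, mul_assoc, ih,
      mul_smul_comm, ← mul_assoc, pow_succ]
    simp

/-- The sign comes from moving `η_n` past the `n - 2` intermediate variables. -/
theorem topCoeff_firstLast_mul (hn : 2 ≤ n) (b : ExteriorAlgebra ℝ (Fin (n - 2) → ℝ)) :
    topCoeff n (frameVar 0 * frameVar (lastIndex n) *
      ExteriorAlgebra.map (midMatrix n).mulVecLin b) = (-1) ^ n * topCoeff (n - 2) b := by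
  have key : topCoeff n ∘ₗ LinearMap.mulLeft ℝ (frameVar 0 * frameVar (lastIndex n)) ∘ₗ
      (ExteriorAlgebra.map (midMatrix n).mulVecLin).toLinearMap =
        (-1 : ℝ) ^ n • topCoeff (n - 2) := by
    have hpair : (frameVar 0 * frameVar (lastIndex n) : ExteriorAlgebra ℝ (Fin n → ℝ)) =
        ExteriorAlgebra.ιMulti ℝ 2 ![Pi.single 0 1, Pi.single (lastIndex n) 1] := by
      simp [ExteriorAlgebra.ιMulti_apply, frameVar]
    refine ExteriorAlgebra.lhom_ext fun i ↦ ?_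
    -- in degree `n - 2` both sides are alternating, so that they are compared on the standard basis
    by_cases hi : i = n - 2
    · subst hi
      refine (AlternatingMap.eq_smul_basis_det (Pi.basisFun ℝ (Fin (n - 2))) _).trans ?_
      rw [Pi.basisFun_det]
      ext v
      simp only [LinearMap.compAlternatingMap_apply, LinearMap.comp_apply, LinearMap.smul_apply,
        AlgHom.toLinearMap_apply, AlternatingMap.smul_apply, topCoeff_ιMulti]
      congr 1
      obtain ⟨N, rfl⟩ : ∃ N, n = N + 2 := ⟨n - 2, by omega⟩
      rw [ExteriorAlgebra.map_apply_ιMulti, LinearMap.mulLeft_apply, mul_assoc]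
      conv_lhs => rw [frameVar, frameVar, ι_mul_ιMulti]
      have h : ExteriorAlgebra.ι ℝ (Pi.single 0 1 : Fin (N + 2) → ℝ) *
          (ExteriorAlgebra.ιMulti ℝ N
            ((midMatrix (N + 2)).mulVecLin ∘ (Pi.basisFun ℝ (Fin N))) *
          ExteriorAlgebra.ι ℝ (Pi.single (lastIndex (N + 2)) 1)) =
          ExteriorAlgebra.ιMulti ℝ (N + 2) (fun i ↦ Pi.single i (1 : ℝ)) := by
        rw [ExteriorAlgebra.ιMulti_succ_apply, ExteriorAlgebra.ιMulti_apply,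
          ExteriorAlgebra.ιMulti_apply, List.ofFn_succ', List.prod_concat]
        congr 1
        congr 1
        congr 2
        ext1 s
        refine congrArg (ExteriorAlgebra.ι ℝ) ?_
        change (midMatrix (N + 2)).mulVecLin (Pi.basisFun ℝ _ s) = Pi.single s.castSucc.succ 1
        rw [Pi.basisFun_apply]
        exact midMatrix_mulVecLin_single (n := N + 2) s
      have h1 := congrArg (topCoeff (N + 2)) h
      have h2 : (Matrix.of fun i : Fin (N + 2) ↦ (Pi.single i 1 : Fin (N + 2) → ℝ)).det = 1 := by
        convert Matrix.det_one (R := ℝ) (n := Fin (N + 2))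
        ext i j
        simp [Matrix.one_apply, Pi.single_apply, eq_comm]
      rw [topCoeff_ιMulti, h2] at h1
      rw [mul_smul_comm, map_smul]
      refine (congrArg (fun r : ℝ ↦ (-1 : ℝ) ^ (N + 2 - 2) • r) h1).trans ?_
      simp [pow_add]
    · ext v
      simp only [LinearMap.compAlternatingMap_apply, LinearMap.comp_apply, LinearMap.smul_apply,
        AlgHom.toLinearMap_apply, topCoeff_ιMulti_of_ne hi, smul_zero,
        ExteriorAlgebra.map_apply_ιMulti, LinearMap.mulLeft_apply, hpair,
        ExteriorAlgebra.ιMulti_mul_ιMulti]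
      exact topCoeff_ιMulti_of_ne (by omega) _
  exact LinearMap.congr_fun key b

theorem berezin_firstLast_mul (hn : 2 ≤ n) (Z : FrameAlg A (n - 2)) :
    berezin A n (firstLast A n * substFrame A (midMatrix n) Z) =
      (-1 : ℝ) ^ n • berezin A (n - 2) Z := by
  induction Z using TensorProduct.induction_on with
  | zero => simp
  | tmul a b =>
    simp [substFrame, firstLast, berezin_tmul, topCoeff_firstLast_mul hn, mul_smul]
  | add x y hx hy => rw [map_add, mul_add, map_add, hx, hy, map_add, smul_add]

end FirstLast

section AdaptedContraction

variable {M : Type*} [AddCommGroup M] [Module ℝ M] {n : ℕ} [NeZero n]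

/-- In a frame adapted to the first and the last vector, the contraction with the angular vector
removes the first and the last frame variable; the two contributions add up to
`cos² + sin² = 1`. -/
theorem contraction_berezin (hn : 2 ≤ n) (δ : Module.Dual ℝ M) (t : ℝ) {u : Fin n → ℝ}
    (hu0 : u 0 = Real.cos t) (hul : u (lastIndex n) = Real.sin t) (hus : ∀ s, u (midEmb n s) = 0)
    {θ : Fin n → M} (hθ0 : δ (θ 0) = -Real.sin t) (hθl : δ (θ (lastIndex n)) = Real.cos t)
    (hθs : ∀ s, δ (θ (midEmb n s)) = 0) {Ω : Fin n → Fin n → ExteriorAlgebra ℝ M}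
    (hΩ : ∀ i j b, contraction δ (Ω i j * b) = Ω i j * contraction δ b) (p k : ℕ) :
    contraction δ (berezin _ n ((1 ⊗ₜ ExteriorAlgebra.ι ℝ u) *
      oddSum (fun i ↦ ExteriorAlgebra.ι ℝ (θ i)) ^ p * evenSum Ω ^ k)) =
      ((-1 : ℝ) ^ n * p) • berezin _ (n - 2)
        (oddSum (fun s ↦ ExteriorAlgebra.ι ℝ (θ (midEmb n s))) ^ (p - 1) *
          evenSum (fun s t ↦ Ω (midEmb n s) (midEmb n t)) ^ k) := by
  have hdecomp (w : Fin n → ℝ) (hw : ∀ s, w (midEmb n s) = 0) :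
      ExteriorAlgebra.ι ℝ w = w 0 • frameVar 0 + w (lastIndex n) • frameVar (lastIndex n) := by
    rw [frameVar, frameVar, ← map_smul, ← map_smul, ← map_add]
    congr 1
    ext i
    have h0l := zero_ne_lastIndex hn
    by_cases h0 : i = 0
    · subst h0; simp [h0l]
    by_cases hl : i = lastIndex n
    · subst hl; simp [h0l.symm]
    obtain ⟨s, rfl⟩ := exists_midEmb_eq h0 hl
    simp [h0, hl, hw]
  have hprod : ((1 : ExteriorAlgebra ℝ M) ⊗ₜ[ℝ] ExteriorAlgebra.ι ℝ u) *
      (1 ⊗ₜ[ℝ] ExteriorAlgebra.ι ℝ fun i ↦ δ (θ i)) = firstLast _ n := by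
    rw [Algebra.TensorProduct.tmul_mul_tmul, mul_one, hdecomp u hus, hdecomp _ hθs, hu0, hul, hθ0,
      hθl, firstLast]
    congr 1
    simp only [add_mul, mul_add, smul_mul_smul_comm]
    rw [frameVar, frameVar, ExteriorAlgebra.ι_sq_zero, ExteriorAlgebra.ι_sq_zero,
      ι_mul_ι_swap (Pi.single (lastIndex n) 1)]
    simp only [smul_zero, zero_add, add_zero, smul_neg, ← neg_smul, ← add_smul]
    convert one_smul ℝ _ using 2
    nlinarith [Real.sin_sq_add_cos_sq t]
  rw [← berezin_frameContraction, mul_assoc, frameContraction_tmul_mul,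
    frameContraction_oddSum_pow_mul δ θ (frameContraction_evenSum_pow δ hΩ k), mul_smul_comm,
    ← mul_assoc, hprod, firstLast_mul_pow_mul_pow, map_smul, berezin_firstLast_mul hn, smul_smul,
    mul_comm (p : ℝ)]

omit [NeZero n] in
theorem oddSum_add_smul {A : Type*} [Ring A] [Algebra ℝ A] (χ ψ : Fin n → A) (a b : ℝ) :
    (oddSum fun s ↦ a • χ s + b • ψ s) = a • oddSum χ + b • oddSum ψ := by
  simp only [oddSum, TensorProduct.add_tmul, Finset.sum_add_distrib, Finset.smul_sum,
    TensorProduct.smul_tmul']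

/-- The binomial expansion of the forms of an adapted frame. -/
theorem oddSum_pow_mul_evenSum_pow {N : ℕ} (χ ψ : Fin N → M) (a b : ℝ)
    {W : Fin N → Fin N → ExteriorAlgebra ℝ M} (hW : ∀ i j b, Commute (W i j) b) (p k : ℕ) :
    (oddSum fun s ↦ ExteriorAlgebra.ι ℝ (a • χ s + b • ψ s)) ^ p *
      (evenSum fun s t ↦ W s t + ExteriorAlgebra.ι ℝ (χ s) * ExteriorAlgebra.ι ℝ (χ t)) ^ k =
      ∑ i ∈ Finset.range (k + 1), ∑ j ∈ Finset.range (p + 1),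
        (a ^ (p - j) * b ^ j * p.choose j * k.choose i) •
          ((oddSum fun s ↦ ExteriorAlgebra.ι ℝ (χ s)) ^ (p - j + 2 * (k - i)) * evenSum W ^ i *
            (oddSum fun s ↦ ExteriorAlgebra.ι ℝ (ψ s)) ^ j) := by
  have hsum : (evenSum fun s t ↦ W s t + ExteriorAlgebra.ι ℝ (χ s) * ExteriorAlgebra.ι ℝ (χ t)) =
      evenSum W + (oddSum fun s ↦ ExteriorAlgebra.ι ℝ (χ s)) ^ 2 := by
    rw [oddSum_mul_self]
    simp only [evenSum, TensorProduct.add_tmul, Finset.sum_add_distrib]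
  simp only [map_add, map_smul, oddSum_add_smul, hsum]
  have hXY := commute_oddSum χ ψ
  have hWZ := commute_evenSum hW
  generalize (oddSum fun s ↦ ExteriorAlgebra.ι ℝ (χ s)) = X at hXY ⊢
  generalize (oddSum fun s ↦ ExteriorAlgebra.ι ℝ (ψ s)) = Y at hXY ⊢
  generalize evenSum W = V at hWZ ⊢
  rw [add_comm (a • X), ((hXY.symm.smul_left b).smul_right a).add_pow,
    ((hWZ _).add_pow), Finset.sum_mul_sum, Finset.sum_comm]
  refine Finset.sum_congr rfl fun i _ ↦ Finset.sum_congr rfl fun j _ ↦ ?_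
  have hc (r : ℕ) (Z : FrameAlg (ExteriorAlgebra ℝ M) N) :
      Z * (r : FrameAlg _ N) = (r : ℝ) • Z := by
    rw [← Nat.cast_comm, ← nsmul_eq_mul, Nat.cast_smul_eq_nsmul]
  rw [hc, hc, smul_pow, smul_pow, smul_mul_smul_comm, smul_mul_smul_comm, smul_mul_assoc,
    smul_smul, pow_add, pow_mul]
  congr 1
  · ring
  · rw [(hXY.symm.pow_pow j (p - j)).eq, ((hWZ (X ^ 2)).pow_pow i (k - i)).eq, mul_assoc, mul_assoc,
      mul_assoc]
    rw [((hWZ Y).pow_pow i j).eq, ← mul_assoc (Y ^ j),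
      ← ((hXY.pow_left 2).pow_pow (k - i) j).eq, mul_assoc]

/-- The arithmetic behind the coefficients `a(i, j)`. -/
theorem coefficient_identity {n i j k : ℕ} (hk : 2 * k + j + 2 ≤ n) (hik : i ≤ k) (c s : ℝ) :
    (-1 : ℝ) ^ k * (1 / ((2 : ℝ) ^ k * (k ! : ℝ) * ((n - 2 * k - 1)‼ : ℝ))) *
      ((-1 : ℝ) ^ n * ((n - 2 * k - 1 : ℕ) : ℝ)) *
      (c ^ (n - 2 * k - 1 - 1 - j) * (-s) ^ j * (n - 2 * k - 1 - 1).choose j * k.choose i) =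
    (-1 : ℝ) ^ (n + j + k) *
      (((n - 2 * k - 2)‼ : ℝ) /
        ((2 : ℝ) ^ k * (j ! : ℝ) * ((n - 2 * k - j - 2)! : ℝ) * (i ! : ℝ) * ((k - i)! : ℝ))) *
      (c ^ (n - 2 * k - j - 2) * s ^ j) := by
  obtain ⟨q, hq⟩ : ∃ q, n = 2 * k + q + 2 := ⟨n - 2 * k - 2, by omega⟩
  have e1 : n - 2 * k - 1 = q + 1 := by omega
  have e2 : n - 2 * k - 2 = q := by omega
  have e3 : n - 2 * k - j - 2 = q - j := by omega
  rw [e1, e2, e3, Nat.add_sub_cancel, Nat.cast_choose ℝ (show j ≤ q by omega),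
    Nat.cast_choose ℝ hik, neg_pow s, pow_add _ (n + j), pow_add _ n]
  have h : ((q + 1 : ℕ) : ℝ) * (q ! : ℝ) = ((q + 1)‼ : ℝ) * (q‼ : ℝ) := by
    rw [← Nat.cast_mul, ← Nat.factorial_succ, Nat.factorial_eq_mul_doubleFactorial, Nat.cast_mul]
  have h1 : ((q + 1)‼ : ℝ) ≠ 0 := by exact_mod_cast (Nat.doubleFactorial_pos _).ne'
  have h2 : (k ! : ℝ) ≠ 0 := by exact_mod_cast k.factorial_ne_zero
  have h3 : (j ! : ℝ) ≠ 0 := by exact_mod_cast j.factorial_ne_zero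
  have h4 : (i ! : ℝ) ≠ 0 := by exact_mod_cast i.factorial_ne_zero
  have h5 : ((k - i)! : ℝ) ≠ 0 := by exact_mod_cast (k - i).factorial_ne_zero
  have h6 : ((q - j)! : ℝ) ≠ 0 := by exact_mod_cast (q - j).factorial_ne_zero
  have h7 : (q‼ : ℝ) = ((q + 1 : ℕ) : ℝ) * (q ! : ℝ) / ((q + 1)‼ : ℝ) := by
    rw [h, mul_div_cancel_left₀ _ h1]
  rw [h7]
  field_simp

/-- The algebraic form of the result: the contraction of the sum of the forms `Φ_k` in an adapted
frame. Here `χ_s`, `ψ_s` and `W_st` stand for `ω_1s`, `ω_sn` and `Ω^M_st`, and the hypothesis on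
`Ω` and `W` is the Gauss equation. -/
theorem contraction_sum_berezin (hn : 3 ≤ n) (δ : Module.Dual ℝ M) (t : ℝ) {u : Fin n → ℝ}
    (hu0 : u 0 = Real.cos t) (hul : u (lastIndex n) = Real.sin t) (hus : ∀ s, u (midEmb n s) = 0)
    {θ : Fin n → M} (hθ0 : δ (θ 0) = -Real.sin t) (hθl : δ (θ (lastIndex n)) = Real.cos t)
    (hθs : ∀ s, δ (θ (midEmb n s)) = 0) {Ω : Fin n → Fin n → ExteriorAlgebra ℝ M}
    (hΩ : ∀ i j b, contraction δ (Ω i j * b) = Ω i j * contraction δ b)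
    {χ ψ : Fin (n - 2) → M} (hθ : ∀ s, θ (midEmb n s) = Real.cos t • χ s + (-Real.sin t) • ψ s)
    {W : Fin (n - 2) → Fin (n - 2) → ExteriorAlgebra ℝ M} (hW : ∀ i j b, Commute (W i j) b)
    (hΩW : ∀ i j, Ω (midEmb n i) (midEmb n j) =
      W i j + ExteriorAlgebra.ι ℝ (χ i) * ExteriorAlgebra.ι ℝ (χ j)) :
    contraction δ (∑ k ∈ Finset.range ((n - 1) / 2 + 1),
      ((-1 : ℝ) ^ k * (1 / ((2 : ℝ) ^ k * (k ! : ℝ) * ((n - 2 * k - 1)‼ : ℝ)))) •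
        berezin _ n ((1 ⊗ₜ ExteriorAlgebra.ι ℝ u) *
          oddSum (fun i ↦ ExteriorAlgebra.ι ℝ (θ i)) ^ (n - 2 * k - 1) * evenSum Ω ^ k)) =
      ∑ ij ∈ regionD1 n, aCoeff n ij.1 ij.2 t • berezin _ (n - 2)
        ((oddSum fun s ↦ ExteriorAlgebra.ι ℝ (χ s)) ^ (n - 2 * ij.1 - ij.2 - 2) *
          evenSum W ^ ij.1 * (oddSum fun s ↦ ExteriorAlgebra.ι ℝ (ψ s)) ^ ij.2) := by
  simp only [map_sum, map_smul,
    contraction_berezin (by omega) δ t hu0 hul hus hθ0 hθl hθs hΩ, hθ, hΩW,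
    oddSum_pow_mul_evenSum_pow χ ψ _ _ hW]
  -- for odd `n`, the last summand has no factor `θ` to contract with
  rw [← Finset.sum_subset (s₁ := Finset.range (n / 2)) (fun k hk ↦ by
    simp only [Finset.mem_range] at hk ⊢; omega) fun k hk hk' ↦ by
    have : n - 2 * k - 1 = 0 := by simp only [Finset.mem_range] at hk hk'; omega
    simp [this]]
  simp only [aCoeff, Finset.sum_smul, Finset.smul_sum, smul_smul, ← Finset.sum_product']
  rw [Finset.sum_comm' (t' := regionD1 n) (s' := fun ij ↦ Finset.Ico ij.1 ((n - ij.2) / 2))]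
  · refine Finset.sum_congr rfl fun ij hij ↦ Finset.sum_congr rfl fun k hk ↦ ?_
    simp only [regionD1, Finset.mem_filter, Finset.mem_product, Finset.mem_range,
      Finset.mem_Ico] at hij hk
    have he : n - 2 * k - 1 - 1 - ij.2 + 2 * (k - ij.1) = n - 2 * ij.1 - ij.2 - 2 := by omega
    rw [he, ← mul_assoc, coefficient_identity (by omega) hk.1, trigT]
  · intro k ij
    simp only [regionD1, Finset.mem_filter, Finset.mem_product, Finset.mem_range, Finset.mem_Ico]
    omega

end AdaptedContraction

/-! ### Two-forms and the exterior derivative -/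

section TwoForms

variable {M : Type*} [AddCommGroup M] [Module ℝ M]

variable (M) in
/-- The exterior forms of degree two. -/
def twoForms : Submodule ℝ (ExteriorAlgebra ℝ M) :=
  Submodule.span ℝ {w | ∃ a b : M, w = ExteriorAlgebra.ι ℝ a * ExteriorAlgebra.ι ℝ b}

theorem ι_mul_ι_mem_twoForms (a b : M) :
    ExteriorAlgebra.ι ℝ a * ExteriorAlgebra.ι ℝ b ∈ twoForms M :=
  Submodule.subset_span ⟨a, b, rfl⟩

theorem commute_of_mem_twoForms {w : ExteriorAlgebra ℝ M} (hw : w ∈ twoForms M)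
    (b : ExteriorAlgebra ℝ M) : Commute w b := by
  induction hw using Submodule.span_induction with
  | mem w hw =>
    obtain ⟨x, y, rfl⟩ := hw
    exact commute_ι_mul_ι x y b
  | zero => exact Commute.zero_left b
  | add x y _ _ hx hy => exact hx.add_left hy
  | smul r x _ hx => exact hx.smul_left r

theorem contraction_mul_of_mem_twoForms (δ : Module.Dual ℝ M) {w : ExteriorAlgebra ℝ M}
    (hw : w ∈ twoForms M) (b : ExteriorAlgebra ℝ M) :
    contraction δ (w * b) = contraction δ w * b + w * contraction δ b := by
  induction hw using Submodule.span_induction with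
  | mem w hw =>
    obtain ⟨x, y, rfl⟩ := hw
    rw [mul_assoc, contraction_ι_mul, contraction_ι_mul, contraction_ι_mul,
      ← mul_one (ExteriorAlgebra.ι ℝ y), contraction_ι_mul, contraction_one]
    simp only [mul_sub, sub_mul, mul_one, mul_zero, sub_zero, mul_smul_comm, smul_mul_assoc,
      mul_assoc]
    abel
  | zero => simp
  | add x y _ _ hx hy => rw [add_mul, map_add, hx, hy, map_add, add_mul, add_mul]; abel
  | smul r x _ hx => rw [smul_mul_assoc, map_smul, hx, map_smul]; simp [smul_add]

end TwoForms

section ExteriorDerivative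

variable {m : ℕ}

theorem toForm_mul_swap (α β : StrongDual ℝ (EuclideanSpace ℝ (Fin m))) :
    toForm α * toForm β = -(toForm β * toForm α) :=
  ι_mul_ι_swap α β

theorem toForm_add (α β : StrongDual ℝ (EuclideanSpace ℝ (Fin m))) :
    toForm (α + β) = toForm α + toForm β := map_add _ _ _

theorem toForm_smul (c : ℝ) (α : StrongDual ℝ (EuclideanSpace ℝ (Fin m))) :
    toForm (c • α) = c • toForm α := map_smul _ _ _

theorem toForm_sum {I : Type*} (s : Finset I) (α : I → StrongDual ℝ (EuclideanSpace ℝ (Fin m))) :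
    toForm (∑ i ∈ s, α i) = ∑ i ∈ s, toForm (α i) := map_sum _ _ _

theorem sum_apply_coordVec_smul_coordForm (α : StrongDual ℝ (EuclideanSpace ℝ (Fin m))) :
    ∑ i, α (coordVec i) • coordForm i = α := by
  ext ξ
  conv_rhs => rw [← (EuclideanSpace.basisFun (Fin m) ℝ).sum_repr ξ]
  simp [coordForm, coordVec, mul_comm]

theorem sum_coordForm_smul_coordVec (ξ : EuclideanSpace ℝ (Fin m)) :
    ∑ i, coordForm i ξ • coordVec i = ξ := by
  conv_rhs => rw [← (EuclideanSpace.basisFun (Fin m) ℝ).sum_repr ξ]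
  simp [coordForm, coordVec]

theorem extD_congr {β γ : EuclideanSpace ℝ (Fin m) → StrongDual ℝ (EuclideanSpace ℝ (Fin m))}
    {y : EuclideanSpace ℝ (Fin m)} (h : β =ᶠ[nhds y] γ) : extD β y = extD γ y := by
  rw [extD, extD, h.fderiv_eq]

theorem extD_add {β γ : EuclideanSpace ℝ (Fin m) → StrongDual ℝ (EuclideanSpace ℝ (Fin m))}
    {y : EuclideanSpace ℝ (Fin m)} (hβ : DifferentiableAt ℝ β y) (hγ : DifferentiableAt ℝ γ y) :
    extD (fun z ↦ β z + γ z) y = extD β y + extD γ y := by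
  simp [extD, fderiv_fun_add hβ hγ, toForm_add, mul_add, Finset.sum_add_distrib]

theorem extD_sum {I : Type*} {s : Finset I}
    {β : I → EuclideanSpace ℝ (Fin m) → StrongDual ℝ (EuclideanSpace ℝ (Fin m))}
    {y : EuclideanSpace ℝ (Fin m)} (hβ : ∀ i ∈ s, DifferentiableAt ℝ (β i) y) :
    extD (fun z ↦ ∑ i ∈ s, β i z) y = ∑ i ∈ s, extD (β i) y := by
  simp only [extD, fderiv_fun_sum hβ, _root_.sum_apply, toForm_sum, Finset.mul_sum]
  exact Finset.sum_comm

theorem extD_smul {c : EuclideanSpace ℝ (Fin m) → ℝ}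
    {β : EuclideanSpace ℝ (Fin m) → StrongDual ℝ (EuclideanSpace ℝ (Fin m))}
    {y : EuclideanSpace ℝ (Fin m)} (hc : DifferentiableAt ℝ c y) (hβ : DifferentiableAt ℝ β y) :
    extD (fun z ↦ c z • β z) y = toForm (fderiv ℝ c y) * toForm (β y) + c y • extD β y := by
  conv_rhs => rw [← sum_apply_coordVec_smul_coordForm (fderiv ℝ c y)]
  simp only [extD, fderiv_fun_smul hc hβ, toForm_sum, Finset.sum_mul, Finset.smul_sum,
    ← Finset.sum_add_distrib]
  refine Finset.sum_congr rfl fun i _ ↦ ?_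
  simp [toForm_add, toForm_smul, mul_add, add_comm]

/-- The exterior derivative of a differential vanishes. -/
theorem extD_fderiv {c : EuclideanSpace ℝ (Fin m) → ℝ} {y : EuclideanSpace ℝ (Fin m)}
    (hc : ContDiffAt ℝ 2 c y) : extD (fderiv ℝ c) y = 0 := by
  have hsymm : IsSymmSndFDerivAt ℝ c y := hc.isSymmSndFDerivAt (by simp)
  have h : extD (fderiv ℝ c) y = ∑ i, ∑ j,
      fderiv ℝ (fderiv ℝ c) y (coordVec i) (coordVec j) •
        (toForm (coordForm i) * toForm (coordForm j)) := by
    refine Finset.sum_congr rfl fun i _ ↦ ?_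
    conv_lhs => rw [← sum_apply_coordVec_smul_coordForm (fderiv ℝ (fderiv ℝ c) y (coordVec i))]
    simp only [toForm_sum, toForm_smul, Finset.mul_sum, mul_smul_comm]
  have h' : extD (fderiv ℝ c) y = -extD (fderiv ℝ c) y := by
    conv_lhs => rw [h, Finset.sum_comm]
    rw [h]
    simp only [← Finset.sum_neg_distrib]
    refine Finset.sum_congr rfl fun i _ ↦ Finset.sum_congr rfl fun j _ ↦ ?_
    rw [toForm_mul_swap, smul_neg, hsymm.eq]
  have h2 : (2 : ℝ) • extD (fderiv ℝ c) y = 0 := by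
    rw [two_smul]
    exact eq_neg_iff_add_eq_zero.1 h'
  simpa using congrArg (fun w ↦ (2⁻¹ : ℝ) • w) h2

theorem extD_mem_twoForms (β : EuclideanSpace ℝ (Fin m) → StrongDual ℝ (EuclideanSpace ℝ (Fin m)))
    (y : EuclideanSpace ℝ (Fin m)) : extD β y ∈ twoForms _ :=
  Submodule.sum_mem _ fun _ _ ↦ ι_mul_ι_mem_twoForms _ _

theorem curvForm_mem_twoForms {n : ℕ} (s : Finset (Fin n))
    (conn : Fin n → Fin n → EuclideanSpace ℝ (Fin m) → StrongDual ℝ (EuclideanSpace ℝ (Fin m)))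
    (A B : Fin n) (y : EuclideanSpace ℝ (Fin m)) : curvForm s conn A B y ∈ twoForms _ :=
  Submodule.sub_mem _ (extD_mem_twoForms _ _)
    (Submodule.sum_mem _ fun _ _ ↦ ι_mul_ι_mem_twoForms _ _)

/-- Evaluation at the vector `ζ`, as an element of the bidual. -/
def evalVec (ζ : EuclideanSpace ℝ (Fin m)) :
    Module.Dual ℝ (StrongDual ℝ (EuclideanSpace ℝ (Fin m))) :=
  (ContinuousLinearMap.apply ℝ ℝ ζ :
    StrongDual ℝ (EuclideanSpace ℝ (Fin m)) →L[ℝ] ℝ).toLinearMap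

theorem evalVec_apply (ζ : EuclideanSpace ℝ (Fin m))
    (α : StrongDual ℝ (EuclideanSpace ℝ (Fin m))) : evalVec ζ α = α ζ := rfl

theorem interiorProd_eq (ζ : EuclideanSpace ℝ (Fin m)) :
    interiorProd ζ = contraction (evalVec ζ) := rfl

theorem contraction_toForm_mul_toForm (ζ : EuclideanSpace ℝ (Fin m))
    (α β : StrongDual ℝ (EuclideanSpace ℝ (Fin m))) :
    contraction (evalVec ζ) (toForm α * toForm β) = toForm (α ζ • β - β ζ • α) := by
  have h := contraction_ι_mul (evalVec ζ) β 1
  rw [mul_one, contraction_one, mul_zero, sub_zero] at h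
  rw [toForm, toForm, contraction_ι_mul, h, evalVec_apply, evalVec_apply, toForm, map_sub, map_smul,
    map_smul, mul_smul_comm, mul_one]

/-- The contraction of `dβ` with `ζ` is `ξ ↦ (D_ζ β) ξ - (D_ξ β) ζ`. -/
theorem contraction_extD (ζ : EuclideanSpace ℝ (Fin m))
    (β : EuclideanSpace ℝ (Fin m) → StrongDual ℝ (EuclideanSpace ℝ (Fin m)))
    (y : EuclideanSpace ℝ (Fin m)) :
    contraction (evalVec ζ) (extD β y) =
      toForm (fderiv ℝ β y ζ - (fderiv ℝ β y).flip ζ) := by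
  rw [extD, map_sum]
  simp only [contraction_toForm_mul_toForm]
  rw [← toForm_sum, Finset.sum_sub_distrib]
  congr 2
  · conv_rhs => rw [← sum_coordForm_smul_coordVec ζ, map_sum]
    simp
  · exact sum_apply_coordVec_smul_coordForm ((fderiv ℝ β y).flip ζ)

/-- If two matrices of connection forms are related by a change of frame `R`, then so are their
matrices of curvature forms. -/
theorem curvForm_change_frame {n : ℕ} {R : Fin n → Fin n → EuclideanSpace ℝ (Fin m) → ℝ}
    {conn conn' : Fin n → Fin n → EuclideanSpace ℝ (Fin m) →
      StrongDual ℝ (EuclideanSpace ℝ (Fin m))} {y : EuclideanSpace ℝ (Fin m)}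
    (hR : ∀ A B, ContDiffAt ℝ 2 (R A B) y) (hc : ∀ A B, DifferentiableAt ℝ (conn A B) y)
    (hc' : ∀ A B, DifferentiableAt ℝ (conn' A B) y)
    (h : ∀ A C, ∀ᶠ z in nhds y, ∑ B, R B C z • conn' A B z =
      fderiv ℝ (R A C) z + ∑ B, R A B z • conn B C z) (A C : Fin n) :
    ∑ B, R B C y • curvForm Finset.univ conn' A B y =
      ∑ B, R A B y • curvForm Finset.univ conn B C y := by
  have hRd (A B) : DifferentiableAt ℝ (R A B) y := (hR A B).differentiableAt (by norm_num)
  have hRd' (A B) : DifferentiableAt ℝ (fderiv ℝ (R A B)) y :=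
    ((hR A B).fderiv_right (m := 1) (by norm_num)).differentiableAt (by norm_num)
  have hd (A C) : ∑ B, (toForm (fderiv ℝ (R B C) y) * toForm (conn' A B y)
      + R B C y • extD (conn' A B) y) =
      ∑ B, (toForm (fderiv ℝ (R A B) y) * toForm (conn B C y) + R A B y • extD (conn B C) y) := by
    have h1 := extD_congr (h A C)
    rw [extD_sum fun B _ ↦ (hRd B C).fun_smul (hc' A B),
      extD_add (hRd' A C) (DifferentiableAt.fun_sum fun B _ ↦ (hRd A B).fun_smul (hc B C)),
      extD_fderiv (hR A C), zero_add, extD_sum fun B _ ↦ (hRd A B).fun_smul (hc B C)] at h1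
    simpa only [extD_smul (hRd _ _) (hc _ _), extD_smul (hRd _ _) (hc' _ _)] using h1
  -- with `S` the matrix of `R`, the differential of `V' S = dS + S V` is combined with itself
  let S : Matrix (Fin n) (Fin n) (ExtForms m) := Matrix.of fun A B ↦ algebraMap ℝ _ (R A B y)
  let dS : Matrix (Fin n) (Fin n) (ExtForms m) := Matrix.of fun A B ↦ toForm (fderiv ℝ (R A B) y)
  let V : Matrix (Fin n) (Fin n) (ExtForms m) := Matrix.of fun A B ↦ toForm (conn A B y)
  let V' : Matrix (Fin n) (Fin n) (ExtForms m) := Matrix.of fun A B ↦ toForm (conn' A B y)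
  let dV : Matrix (Fin n) (Fin n) (ExtForms m) := Matrix.of fun A B ↦ extD (conn A B) y
  let dV' : Matrix (Fin n) (Fin n) (ExtForms m) := Matrix.of fun A B ↦ extD (conn' A B) y
  have e1 : V' * S = dS + S * V := by
    ext A C
    have := congrArg toForm (h A C).self_of_nhds
    simp only [toForm_add, toForm_sum, toForm_smul] at this
    simpa only [Matrix.mul_apply, Matrix.add_apply, V', S, dS, V, Matrix.of_apply,
      ← Algebra.commutes, ← Algebra.smul_def] using this
  have e2 : dV' * S - V' * dS = dS * V + S * dV := by
    ext A C
    have := hd A C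
    simp only [Finset.sum_add_distrib, toForm_mul_swap (fderiv ℝ (R _ C) y),
      Finset.sum_neg_distrib] at this
    simp only [Matrix.mul_apply, Matrix.add_apply, Matrix.sub_apply, V', S, dS, V, dV, dV',
      Matrix.of_apply, ← Algebra.commutes (R _ _ y) (extD _ y), ← Algebra.smul_def]
    rw [← this]
    abel
  have e3 : (dV' - V' * V') * S = S * (dV - V * V) := by
    have : (dV' - V' * V') * S = (dV' * S - V' * dS) + V' * dS - V' * (V' * S) := by
      noncomm_ring
    rw [this, e2, e1, mul_add, ← mul_assoc V' S, e1]
    noncomm_ring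
  have := congrFun (congrFun e3 A) C
  simp only [Matrix.mul_apply, Matrix.sub_apply, V', S, V, dV, dV',
      Matrix.of_apply, ← Algebra.commutes (R _ _ y) (_ - _), ← Algebra.smul_def] at this
  exact this

end ExteriorDerivative

/-! ### Metric connections along a map -/

section MetricConnection

set_option synthInstance.maxHeartbeats 200000
set_option maxSynthPendingDepth 6

variable {F : Type*} [NormedAddCommGroup F] [NormedSpace ℝ F] {m : ℕ}

/-- A metric `g` on the trivial bundle with fibre `F` over the open set `U` of `ℝᵐ`, and a metric
connection: `k z ξ a b` stands for `⟨∇_ξ a, b⟩`, for constant sections `a` and `b`. -/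
structure IsMetricConnection (U : Set (EuclideanSpace ℝ (Fin m)))
    (g : EuclideanSpace ℝ (Fin m) → F →L[ℝ] F →L[ℝ] ℝ)
    (k : EuclideanSpace ℝ (Fin m) → EuclideanSpace ℝ (Fin m) →L[ℝ] F →L[ℝ] F →L[ℝ] ℝ) : Prop where
  isOpen : IsOpen U
  contDiffOn_metric : ContDiffOn ℝ ∞ g U
  contDiffOn_conn : ContDiffOn ℝ ∞ k U
  symm : ∀ z ∈ U, ∀ a b, g z a b = g z b a
  compat : ∀ z ∈ U, ∀ ξ a b, fderiv ℝ g z ξ a b = k z ξ a b + k z ξ b a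

variable {U : Set (EuclideanSpace ℝ (Fin m))}
  {g : EuclideanSpace ℝ (Fin m) → F →L[ℝ] F →L[ℝ] ℝ}
  {k : EuclideanSpace ℝ (Fin m) → EuclideanSpace ℝ (Fin m) →L[ℝ] F →L[ℝ] F →L[ℝ] ℝ}

/-- The one-form `ξ ↦ ⟨∇_ξ a, b⟩`. -/
def covForm (g : EuclideanSpace ℝ (Fin m) → F →L[ℝ] F →L[ℝ] ℝ)
    (k : EuclideanSpace ℝ (Fin m) → EuclideanSpace ℝ (Fin m) →L[ℝ] F →L[ℝ] F →L[ℝ] ℝ)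
    (a b : EuclideanSpace ℝ (Fin m) → F) (z : EuclideanSpace ℝ (Fin m)) :
    StrongDual ℝ (EuclideanSpace ℝ (Fin m)) :=
  ((g z).flip (b z)).comp (fderiv ℝ a z) + ((k z).flip (a z)).flip (b z)

theorem covForm_apply (a b : EuclideanSpace ℝ (Fin m) → F) (z ξ : EuclideanSpace ℝ (Fin m)) :
    covForm g k a b z ξ = g z (fderiv ℝ a z ξ) (b z) + k z ξ (a z) (b z) := rfl

theorem two_le_infty : (2 : WithTop ℕ∞) ≤ ∞ :=
  WithTop.coe_le_coe.2 le_top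

namespace IsMetricConnection

variable (H : IsMetricConnection U g k)

include H

theorem contDiffOn_inner {a b : EuclideanSpace ℝ (Fin m) → F} (ha : ContDiffOn ℝ ∞ a U)
    (hb : ContDiffOn ℝ ∞ b U) : ContDiffOn ℝ ∞ (fun z ↦ g z (a z) (b z)) U :=
  (H.contDiffOn_metric.clm_apply ha).clm_apply hb

theorem contDiffOn_covForm {a b : EuclideanSpace ℝ (Fin m) → F} (ha : ContDiffOn ℝ ∞ a U)
    (hb : ContDiffOn ℝ ∞ b U) : ContDiffOn ℝ ∞ (covForm g k a b) U := by
  rw [contDiffOn_clm_apply]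
  intro ξ
  have hda : ContDiffOn ℝ ∞ (fun z ↦ fderiv ℝ a z ξ) U :=
    (ha.fderiv_of_isOpen H.isOpen (by simp)).clm_apply contDiffOn_const
  exact ((H.contDiffOn_metric.clm_apply hda).clm_apply hb).add
    (((H.contDiffOn_conn.clm_apply contDiffOn_const).clm_apply ha).clm_apply hb)

omit H in
theorem _root_.ContDiffOn.differentiableAt_of_isOpen {G : Type*} [NormedAddCommGroup G]
    [NormedSpace ℝ G] {E : Type*} [NormedAddCommGroup E] [NormedSpace ℝ E] {V : Set E}
    {f : E → G} (hf : ContDiffOn ℝ ∞ f V) (hV : IsOpen V) {z : E} (hz : z ∈ V) :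
    DifferentiableAt ℝ f z :=
  (hf.contDiffAt (hV.mem_nhds hz)).differentiableAt (by simp)

/-- The product rule for the metric. -/
theorem fderiv_inner {a b : EuclideanSpace ℝ (Fin m) → F} (ha : ContDiffOn ℝ ∞ a U)
    (hb : ContDiffOn ℝ ∞ b U) {z : EuclideanSpace ℝ (Fin m)} (hz : z ∈ U) :
    fderiv ℝ (fun z ↦ g z (a z) (b z)) z = covForm g k a b z + covForm g k b a z := by
  have hg := (H.contDiffOn_metric.differentiableAt_of_isOpen H.isOpen hz).hasFDerivAt
  have ha' := (ha.differentiableAt_of_isOpen H.isOpen hz).hasFDerivAt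
  have hb' := (hb.differentiableAt_of_isOpen H.isOpen hz).hasFDerivAt
  rw [((hg.clm_apply ha').clm_apply hb').fderiv]
  ext ξ
  simp [covForm_apply, H.compat z hz, H.symm z hz (a z)]
  ring

end IsMetricConnection

/-- A smooth orthonormal frame of the trivial bundle with fibre `F`. -/
structure IsOrthoFrame {n : ℕ} (U : Set (EuclideanSpace ℝ (Fin m)))
    (g : EuclideanSpace ℝ (Fin m) → F →L[ℝ] F →L[ℝ] ℝ)
    (e : Fin n → EuclideanSpace ℝ (Fin m) → F) : Prop where
  contDiffOn : ∀ A, ContDiffOn ℝ ∞ (e A) U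
  ortho : ∀ z ∈ U, ∀ A B, g z (e A z) (e B z) = if A = B then 1 else 0
  expand : ∀ z ∈ U, ∀ w, ∑ B, g z w (e B z) • e B z = w

namespace IsMetricConnection

variable (H : IsMetricConnection U g k) {n : ℕ} {e f : Fin n → EuclideanSpace ℝ (Fin m) → F}
  (he : IsOrthoFrame U g e) (hf : IsOrthoFrame U g f)

include H

include he in
theorem covForm_antisymm (A B : Fin n) {z : EuclideanSpace ℝ (Fin m)} (hz : z ∈ U) :
    covForm g k (e A) (e B) z = -covForm g k (e B) (e A) z := by
  have h := H.fderiv_inner (he.contDiffOn A) (he.contDiffOn B) hz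
  have h' : (fun z ↦ g z (e A z) (e B z)) =ᶠ[nhds z] fun _ ↦ if A = B then (1 : ℝ) else 0 := by
    filter_upwards [H.isOpen.mem_nhds hz] with w hw using he.ortho w hw A B
  rw [h'.fderiv_eq, fderiv_fun_const] at h
  exact eq_neg_of_add_eq_zero_left h.symm

omit H in
include he in
theorem covForm_expand (a c : EuclideanSpace ℝ (Fin m) → F) {z : EuclideanSpace ℝ (Fin m)}
    (hz : z ∈ U) :
    ∑ B, g z (c z) (e B z) • covForm g k a (e B) z = covForm g k a c z := by
  ext ξ
  conv_rhs => rw [covForm_apply, ← he.expand z hz (c z)]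
  simp only [map_sum, map_smul, _root_.sum_apply, _root_.smul_apply, covForm_apply,
    ← Finset.sum_add_distrib, smul_add]

include he in
theorem sum_smul_covForm (c : EuclideanSpace ℝ (Fin m) → F) {z : EuclideanSpace ℝ (Fin m)}
    (hz : z ∈ U) (A : Fin n) :
    ∑ B, g z (c z) (e B z) • covForm g k (e B) (e A) z = -covForm g k (e A) c z := by
  rw [← covForm_expand he (e A) c hz, ← Finset.sum_neg_distrib]
  exact Finset.sum_congr rfl fun B _ ↦ by rw [H.covForm_antisymm he B A hz, smul_neg]

include he in
/-- The form `θ_A = du_A + ∑_B u_B ω_BA` of the section `v` is `⟨∇v, e_A⟩`. -/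
theorem fderiv_add_sum_eq_covForm {v : EuclideanSpace ℝ (Fin m) → F} (hv : ContDiffOn ℝ ∞ v U)
    {z : EuclideanSpace ℝ (Fin m)} (hz : z ∈ U) (A : Fin n) :
    fderiv ℝ (fun z ↦ g z (v z) (e A z)) z +
      ∑ B, g z (v z) (e B z) • covForm g k (e B) (e A) z = covForm g k v (e A) z := by
  rw [H.sum_smul_covForm he v hz, H.fderiv_inner hv (he.contDiffOn A) hz]
  abel

include he hf in
theorem sum_smul_covForm_eq {z : EuclideanSpace ℝ (Fin m)} (hz : z ∈ U) (A C : Fin n) :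
    ∑ B, g z (f B z) (e C z) • covForm g k (f A) (f B) z =
      fderiv ℝ (fun z ↦ g z (f A z) (e C z)) z +
        ∑ B, g z (f A z) (e B z) • covForm g k (e B) (e C) z := by
  rw [H.fderiv_add_sum_eq_covForm he (hf.contDiffOn A) hz, ← covForm_expand hf (f A) (e C) hz]
  exact Finset.sum_congr rfl fun B _ ↦ by rw [H.symm z hz]

include he hf in
/-- The curvature forms in two orthonormal frames are related by the change of frame. -/
theorem curvForm_change (y : EuclideanSpace ℝ (Fin m)) (hy : y ∈ U) (A C : Fin n) :
    ∑ B, g y (f B y) (e C y) • curvForm Finset.univ (fun A B ↦ covForm g k (f A) (f B)) A B y =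
      ∑ B, g y (f A y) (e B y) •
        curvForm Finset.univ (fun A B ↦ covForm g k (e A) (e B)) B C y := by
  refine curvForm_change_frame (R := fun A B z ↦ g z (f A z) (e B z)) (fun A B ↦ ?_)
    (fun A B ↦ ?_) (fun A B ↦ ?_) (fun A C ↦ ?_) A C
  · exact ((H.contDiffOn_inner (hf.contDiffOn A) (he.contDiffOn B)).contDiffAt
      (H.isOpen.mem_nhds hy)).of_le two_le_infty
  · exact (H.contDiffOn_covForm (he.contDiffOn A) (he.contDiffOn B)).differentiableAt_of_isOpen
      H.isOpen hy
  · exact (H.contDiffOn_covForm (hf.contDiffOn A) (hf.contDiffOn B)).differentiableAt_of_isOpen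
      H.isOpen hy
  · filter_upwards [H.isOpen.mem_nhds hy] with z hz using H.sum_smul_covForm_eq he hf hz A C

/-- The derivative of a connection form, with the derivative of the metric expressed by the
connection. -/
theorem fderiv_covForm_apply {a b : EuclideanSpace ℝ (Fin m) → F} (ha : ContDiffOn ℝ ∞ a U)
    (hb : ContDiffOn ℝ ∞ b U) {z : EuclideanSpace ℝ (Fin m)} (hz : z ∈ U)
    (η ξ : EuclideanSpace ℝ (Fin m)) :
    fderiv ℝ (covForm g k a b) z η ξ =
      (k z η (fderiv ℝ a z ξ) (b z) + k z η (b z) (fderiv ℝ a z ξ)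
        + g z (fderiv ℝ (fderiv ℝ a) z η ξ) (b z) + g z (fderiv ℝ a z ξ) (fderiv ℝ b z η)) +
      (fderiv ℝ k z η ξ (a z) (b z) + k z ξ (fderiv ℝ a z η) (b z)
        + k z ξ (a z) (fderiv ℝ b z η)) := by
  have hg := (H.contDiffOn_metric.differentiableAt_of_isOpen H.isOpen hz).hasFDerivAt
  have hk := (H.contDiffOn_conn.differentiableAt_of_isOpen H.isOpen hz).hasFDerivAt
  have ha' := (ha.differentiableAt_of_isOpen H.isOpen hz).hasFDerivAt
  have hb' := (hb.differentiableAt_of_isOpen H.isOpen hz).hasFDerivAt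
  have hda : HasFDerivAt (fderiv ℝ a) (fderiv ℝ (fderiv ℝ a) z) z :=
    ((ha.fderiv_of_isOpen H.isOpen (m := ∞) (by simp)).differentiableAt_of_isOpen
      H.isOpen hz).hasFDerivAt
  have hξ := hasFDerivAt_const (𝕜 := ℝ) ξ z
  have h := ((hg.clm_apply (hda.clm_apply hξ)).clm_apply hb').add
    (((hk.clm_apply hξ).clm_apply ha').clm_apply hb')
  have h0 := (((H.contDiffOn_covForm ha hb).differentiableAt_of_isOpen H.isOpen
    hz).hasFDerivAt.clm_apply hξ)
  have := congrArg (fun L ↦ L η) (h0.unique h)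
  simp at this
  rw [this, H.compat z hz]
  ring

include he in
/-- The contraction of the curvature forms with `ζ` vanishes if the connection coefficients `k` and
their differential have no component along `ζ`, as for the pullback of a connection by a map whose
differential kills `ζ`. -/
theorem contraction_curvForm_eq_zero {y : EuclideanSpace ℝ (Fin m)} (hy : y ∈ U)
    {ζ : EuclideanSpace ℝ (Fin m)} (hk0 : k y ζ = 0)
    (hk : ∀ ξ, fderiv ℝ k y ζ ξ = fderiv ℝ k y ξ ζ) (A B : Fin n) :
    contraction (evalVec ζ)
      (curvForm Finset.univ (fun A B ↦ covForm g k (e A) (e B)) A B y) = 0 := by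
  rw [curvForm, map_sub, map_sum, contraction_extD]
  simp only [contraction_toForm_mul_toForm]
  rw [← toForm_sum, toForm, toForm, ← map_sub]
  refine (congrArg _ ?_).trans (map_zero (ExteriorAlgebra.ι ℝ))
  ext ξ
  have hD2 : fderiv ℝ (fderiv ℝ (e A)) y ζ ξ = fderiv ℝ (fderiv ℝ (e A)) y ξ ζ :=
    (((he.contDiffOn A).contDiffAt (H.isOpen.mem_nhds hy)).isSymmSndFDerivAt
      (by simpa using two_le_infty)).eq _ _
  have hζ (C D : Fin n) : covForm g k (e C) (e D) y ζ = g y (fderiv ℝ (e C) y ζ) (e D y) := by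
    rw [covForm_apply, hk0]; simp
  -- the products of connection forms are summed by expanding `D_ζ e_A` and `D_ζ e_B` in the frame
  have h1 : ∑ C, covForm g k (e A) (e C) y ζ * covForm g k (e C) (e B) y ξ =
      -(g y (fderiv ℝ (e B) y ξ) (fderiv ℝ (e A) y ζ) +
        k y ξ (e B y) (fderiv ℝ (e A) y ζ)) := by
    have := congrArg (fun L ↦ L ξ) (H.sum_smul_covForm he (fun _ ↦ fderiv ℝ (e A) y ζ) hy B)
    simpa [hζ, covForm_apply] using this
  have h2 : ∑ C, covForm g k (e C) (e B) y ζ * covForm g k (e A) (e C) y ξ =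
      -(g y (fderiv ℝ (e A) y ξ) (fderiv ℝ (e B) y ζ) +
        k y ξ (e A y) (fderiv ℝ (e B) y ζ)) := by
    have := congrArg (fun L ↦ L ξ) (covForm_expand (k := k) he (e A)
      (fun _ ↦ fderiv ℝ (e B) y ζ) hy)
    simp only [H.covForm_antisymm he _ B hy, _root_.neg_apply, neg_mul, hζ,
      Finset.sum_neg_distrib]
    rw [neg_inj]
    simpa [covForm_apply] using this
  simp only [_root_.sub_apply, ContinuousLinearMap.flip_apply,
    _root_.zero_apply, _root_.sum_apply, _root_.smul_apply, smul_eq_mul,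
    Finset.sum_sub_distrib, h1, h2, H.fderiv_covForm_apply (he.contDiffOn A) (he.contDiffOn B) hy,
    hk0, hk ξ, hD2]
  rw [H.symm y hy (fderiv ℝ (e B) y ξ)]
  ring

end IsMetricConnection

end MetricConnection

/-! ### The Levi-Civita connection along a map to a chart -/

section LeviCivita

set_option synthInstance.maxHeartbeats 200000
set_option maxSynthPendingDepth 6

variable {F : Type*} [NormedAddCommGroup F] [NormedSpace ℝ F] [FiniteDimensional ℝ F] {m : ℕ}

/-- The metric `G` on the subset `S` of the vector space `F` is represented on the relatively open
subset `T` of `S` by the smooth family `γ` of continuous bilinear forms. -/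
structure IsSmoothMetric (G : F → F → F → ℝ) (S T : Set F) (γ : F → F →L[ℝ] F →L[ℝ] ℝ) : Prop where
  subset : T ⊆ S
  eventuallyEq : ∀ p ∈ T, S =ᶠ[nhds p] T
  uniqueDiffOn : UniqueDiffOn ℝ T
  apply_eq : ∀ p ∈ T, ∀ a b, G p a b = γ p a b
  contDiffOn : ContDiffOn ℝ ∞ γ T
  symm : ∀ p ∈ T, ∀ a b, γ p a b = γ p b a

variable {G : F → F → F → ℝ} {S T : Set F} {γ : F → F →L[ℝ] F →L[ℝ] ℝ}

/-- The Christoffel symbol of the first kind as a trilinear map. -/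
def christoffelMap (T : Set F) (γ : F → F →L[ℝ] F →L[ℝ] ℝ) (p : F) : F →L[ℝ] F →L[ℝ] F →L[ℝ] ℝ :=
  (2⁻¹ : ℝ) • (fderivWithin ℝ γ T p + (fderivWithin ℝ γ T p).flip -
    ((ContinuousLinearMap.flipₗᵢ ℝ F F ℝ).toContinuousLinearEquiv : _ →L[ℝ] F →L[ℝ] F →L[ℝ] ℝ).comp
      (fderivWithin ℝ γ T p).flip)

omit [FiniteDimensional ℝ F] in
theorem christoffelMap_apply (p a b c : F) :
    christoffelMap T γ p a b c = (fderivWithin ℝ γ T p a b c + fderivWithin ℝ γ T p b a c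
      - fderivWithin ℝ γ T p c a b) / 2 := by
  simp [christoffelMap, div_eq_inv_mul]

namespace IsSmoothMetric

variable (H : IsSmoothMetric G S T γ)

include H

omit [FiniteDimensional ℝ F] in
theorem hasFDerivWithinAt {p : F} (hp : p ∈ T) :
    HasFDerivWithinAt γ (fderivWithin ℝ γ T p) T p :=
  ((H.contDiffOn p hp).differentiableWithinAt (by simp)).hasFDerivWithinAt

omit [FiniteDimensional ℝ F] in
theorem hasFDerivWithinAt_apply {p : F} (hp : p ∈ T) (b c : F) :
    HasFDerivWithinAt (fun p ↦ G p b c)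
      (((fderivWithin ℝ γ T p).flip b).flip c) S p := by
  have h := ((H.hasFDerivWithinAt hp).clm_apply (hasFDerivWithinAt_const b p T)).clm_apply
    (hasFDerivWithinAt_const c p T)
  rw [hasFDerivWithinAt_congr_set (H.eventuallyEq p hp)]
  refine (h.congr (fun r hr ↦ H.apply_eq r hr b c) (H.apply_eq p hp b c)).congr_fderiv ?_
  ext a
  simp

omit [FiniteDimensional ℝ F] in
theorem fderivWithin_apply {p : F} (hp : p ∈ T) (a b c : F) :
    fderivWithin ℝ (fun p ↦ G p b c) S p a = fderivWithin ℝ γ T p a b c := by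
  have hu : UniqueDiffWithinAt ℝ S p := (H.uniqueDiffOn p hp).mono H.subset
  rw [(H.hasFDerivWithinAt_apply hp b c).fderivWithin hu]
  rfl

omit [FiniteDimensional ℝ F] in
theorem christoffel_eq {p : F} (hp : p ∈ T) (a b c : F) :
    christoffel G S p a b c = christoffelMap T γ p a b c := by
  rw [christoffel, christoffelMap_apply, H.fderivWithin_apply hp, H.fderivWithin_apply hp,
    H.fderivWithin_apply hp]

theorem contDiffOn_christoffelMap : ContDiffOn ℝ ∞ (christoffelMap T γ) T := by
  have hd : ContDiffOn ℝ ∞ (fderivWithin ℝ γ T) T :=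
    H.contDiffOn.fderivWithin H.uniqueDiffOn (by simp)
  have h (a b c : F) : ContDiffOn ℝ ∞ (fun p ↦ fderivWithin ℝ γ T p a b c) T :=
    ((hd.clm_apply contDiffOn_const).clm_apply contDiffOn_const).clm_apply contDiffOn_const
  rw [contDiffOn_clm_apply]
  intro a
  rw [contDiffOn_clm_apply]
  intro b
  rw [contDiffOn_clm_apply]
  intro c
  simp only [christoffelMap_apply]
  exact (((h a b c).add (h b a c)).sub (h c a b)).div_const 2

omit [FiniteDimensional ℝ F] in
theorem fderivWithin_symm {p : F} (hp : p ∈ T) (a b c : F) :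
    fderivWithin ℝ γ T p a b c = fderivWithin ℝ γ T p a c b := by
  rw [← H.fderivWithin_apply hp, ← H.fderivWithin_apply hp]
  have h : ∀ᶠ r in nhdsWithin p S, G r b c = G r c b := by
    rw [nhdsWithin_eq_iff_eventuallyEq.2 (H.eventuallyEq p hp)]
    filter_upwards [self_mem_nhdsWithin] with r hr
    rw [H.apply_eq r hr, H.apply_eq r hr, H.symm r hr]
  rw [Filter.EventuallyEq.fderivWithin_eq h (by
    rw [H.apply_eq p hp, H.apply_eq p hp, H.symm p hp])]

variable {U : Set (EuclideanSpace ℝ (Fin m))} {q : EuclideanSpace ℝ (Fin m) → F} (hU : IsOpen U)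
  (hq : ContDiffOn ℝ ∞ q U) (hqT : MapsTo q U T)

omit H [FiniteDimensional ℝ F] in
/-- The coefficients of the pullback of the Levi-Civita connection by the map `q`. -/
def _root_.pullbackConn (T : Set F) (γ : F → F →L[ℝ] F →L[ℝ] ℝ) (q : EuclideanSpace ℝ (Fin m) → F)
    (z : EuclideanSpace ℝ (Fin m)) : EuclideanSpace ℝ (Fin m) →L[ℝ] F →L[ℝ] F →L[ℝ] ℝ :=
  (christoffelMap T γ (q z)).comp (fderiv ℝ q z)

include hU hq hqT

/-- The pullback of the Levi-Civita connection is a metric connection. -/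
theorem isMetricConnection :
    IsMetricConnection U (fun z ↦ γ (q z)) (pullbackConn T γ q) where
  isOpen := hU
  contDiffOn_metric := H.contDiffOn.comp hq hqT
  contDiffOn_conn := (H.contDiffOn_christoffelMap.comp hq hqT).clm_comp
    (hq.fderiv_of_isOpen hU (by simp))
  symm z hz := H.symm _ (hqT hz)
  compat z hz ξ a b := by
    have h := ((H.hasFDerivWithinAt (hqT hz)).comp z
      (hq.differentiableAt_of_isOpen hU hz).hasFDerivAt.hasFDerivWithinAt hqT).hasFDerivAt
        (hU.mem_nhds hz)
    rw [show (fun z ↦ γ (q z)) = γ ∘ q from rfl, h.fderiv]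
    simp only [pullbackConn, ContinuousLinearMap.comp_apply, christoffelMap_apply]
    rw [H.fderivWithin_symm (hqT hz) (fderiv ℝ q z ξ) b a]
    ring

omit hU hq [FiniteDimensional ℝ F] in
theorem connForm_eq (a b : EuclideanSpace ℝ (Fin m) → F) {z : EuclideanSpace ℝ (Fin m)}
    (hz : z ∈ U) :
    connForm G S q a b z = covForm (fun z ↦ γ (q z)) (pullbackConn T γ q) a b z := by
  rw [← sum_apply_coordVec_smul_coordForm (covForm _ _ a b z)]
  refine Finset.sum_congr rfl fun i _ ↦ ?_
  rw [covForm_apply, H.apply_eq _ (hqT hz), H.christoffel_eq (hqT hz)]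
  rfl

/-- In the derivative of the coefficients `Γ(q) ∘ dq` at a point where `dq` kills `ζ`, the
derivative of `Γ` drops out, and the second derivative of `q` is symmetric. -/
theorem fderiv_pullbackConn_swap {y ζ : EuclideanSpace ℝ (Fin m)} (hy : y ∈ U)
    (hζ : fderiv ℝ q y ζ = 0) (ξ : EuclideanSpace ℝ (Fin m)) :
    fderiv ℝ (pullbackConn T γ q) y ζ ξ = fderiv ℝ (pullbackConn T γ q) y ξ ζ := by
  have hκ : HasFDerivWithinAt (christoffelMap T γ)
      (fderivWithin ℝ (christoffelMap T γ) T (q y)) T (q y) :=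
    ((H.contDiffOn_christoffelMap _ (hqT hy)).differentiableWithinAt (by simp)).hasFDerivWithinAt
  have h := (hκ.comp y (hq.differentiableAt_of_isOpen hU hy).hasFDerivAt.hasFDerivWithinAt
    hqT).hasFDerivAt (hU.mem_nhds hy)
  have hdq : HasFDerivAt (fderiv ℝ q) (fderiv ℝ (fderiv ℝ q) y) y :=
    ((hq.fderiv_of_isOpen hU (m := ∞) (by simp)).differentiableAt_of_isOpen hU hy).hasFDerivAt
  have hsymm : fderiv ℝ (fderiv ℝ q) y ζ ξ = fderiv ℝ (fderiv ℝ q) y ξ ζ :=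
    ((hq.contDiffAt (hU.mem_nhds hy)).isSymmSndFDerivAt (by simpa using two_le_infty)).eq _ _
  have hk : HasFDerivAt (pullbackConn T γ q) _ y := h.clm_comp hdq
  rw [hk.fderiv]
  simp [hζ, hsymm]

end IsSmoothMetric

end LeviCivita

/-! ### The induced connection on the boundary hyperplane -/

section BoundaryConnection

variable {n m : ℕ} [NeZero n]

theorem coe_toBoundaryModel {w : EuclideanSpace ℝ (Fin n)} (hw : w 0 = 0) :
    (toBoundaryModel n w : EuclideanSpace ℝ (Fin n)) = w :=
  (BoundaryModel n).starProjection_eq_self_iff.2 hw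

theorem fderiv_apply_zero_of_eventually {a : EuclideanSpace ℝ (Fin m) → EuclideanSpace ℝ (Fin n)}
    {z : EuclideanSpace ℝ (Fin m)} (ha : DifferentiableAt ℝ a z)
    (h : ∀ᶠ w in nhds z, a w 0 = 0) (ξ : EuclideanSpace ℝ (Fin m)) : fderiv ℝ a z ξ 0 = 0 := by
  have h1 := ((EuclideanSpace.proj (0 : Fin n) : EuclideanSpace ℝ (Fin n) →L[ℝ] ℝ).hasFDerivAt.comp
    z ha.hasFDerivAt).fderiv
  have h2 : (EuclideanSpace.proj (0 : Fin n) : EuclideanSpace ℝ (Fin n) →L[ℝ] ℝ) ∘ a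
      =ᶠ[nhds z] fun _ ↦ (0 : ℝ) := h
  rw [h2.fderiv_eq, fderiv_fun_const] at h1
  exact (congrArg (fun L ↦ L ξ) h1).symm

theorem fderiv_toBoundaryModel {a : EuclideanSpace ℝ (Fin m) → EuclideanSpace ℝ (Fin n)}
    {z : EuclideanSpace ℝ (Fin m)} (ha : DifferentiableAt ℝ a z)
    (h : ∀ᶠ w in nhds z, a w 0 = 0) (ξ : EuclideanSpace ℝ (Fin m)) :
    (fderiv ℝ (fun w ↦ toBoundaryModel n (a w)) z ξ : EuclideanSpace ℝ (Fin n)) =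
      fderiv ℝ a z ξ := by
  obtain ⟨P, hP⟩ : ∃ P : EuclideanSpace ℝ (Fin n) →L[ℝ] BoundaryModel n,
      ∀ w, toBoundaryModel n w = P w := ⟨_, fun _ ↦ rfl⟩
  have h1 := (P.hasFDerivAt.comp z ha.hasFDerivAt).fderiv
  simp only [hP]
  rw [show (fun w ↦ P (a w)) = P ∘ a from rfl, h1, ContinuousLinearMap.comp_apply, ← hP]
  exact coe_toBoundaryModel (fderiv_apply_zero_of_eventually ha h ξ)

/-- For vector fields tangent to the boundary hyperplane, the connection forms of the metric and of
its restriction to the hyperplane agree. -/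
theorem connForm_boundary {G : EuclideanSpace ℝ (Fin n) → EuclideanSpace ℝ (Fin n) →
      EuclideanSpace ℝ (Fin n) → ℝ} {S T : Set (EuclideanSpace ℝ (Fin n))}
    {γ : EuclideanSpace ℝ (Fin n) → EuclideanSpace ℝ (Fin n) →L[ℝ]
      EuclideanSpace ℝ (Fin n) →L[ℝ] ℝ}
    (H : IsSmoothMetric G S T γ) (hS : ∀ p : EuclideanSpace ℝ (Fin n), p 0 = 0 → p ∈ S)
    {q a b : EuclideanSpace ℝ (Fin m) → EuclideanSpace ℝ (Fin n)} {z : EuclideanSpace ℝ (Fin m)}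
    (hqT : q z ∈ T) (hq : DifferentiableAt ℝ q z) (ha : DifferentiableAt ℝ a z)
    (hq0 : ∀ᶠ w in nhds z, q w 0 = 0) (ha0 : ∀ᶠ w in nhds z, a w 0 = 0) (hb0 : b z 0 = 0) :
    connForm (fun p a b : BoundaryModel n ↦ G p a b) univ (fun w ↦ toBoundaryModel n (q w))
      (fun w ↦ toBoundaryModel n (a w)) (fun w ↦ toBoundaryModel n (b w)) z =
      connForm G S q a b z := by
  have hqz := coe_toBoundaryModel hq0.self_of_nhds
  have hd (u v w : BoundaryModel n) :
      fderivWithin ℝ (fun p : BoundaryModel n ↦ G p v w) univ (toBoundaryModel n (q z)) u =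
        fderivWithin ℝ (fun p ↦ G p v w) S (q z) u := by
    have h := H.hasFDerivWithinAt_apply hqT v w
    have h1 : HasFDerivWithinAt (fun p ↦ G p v w)
        (((fderivWithin ℝ γ T (q z)).flip v).flip w) S
        ((BoundaryModel n).subtypeL (toBoundaryModel n (q z))) := by
      rw [Submodule.subtypeL_apply, hqz]; exact h
    have h2 := h1.comp (toBoundaryModel n (q z))
      ((BoundaryModel n).subtypeL.hasFDerivAt.hasFDerivWithinAt (s := univ))
      fun p _ ↦ hS _ p.2
    rw [hasFDerivWithinAt_univ] at h2
    have hu : UniqueDiffWithinAt ℝ S (q z) := (H.uniqueDiffOn _ hqT).mono H.subset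
    rw [fderivWithin_univ, h.fderivWithin hu]
    exact congrArg (fun L ↦ L u) h2.fderiv
  refine Finset.sum_congr rfl fun i _ ↦ ?_
  simp only [christoffel, hd]
  simp only [fderiv_toBoundaryModel ha ha0, fderiv_toBoundaryModel hq hq0, hqz,
    coe_toBoundaryModel ha0.self_of_nhds, coe_toBoundaryModel hb0]

end BoundaryConnection

/-! ### Charts of a Riemannian manifold with boundary -/

section Charts

set_option synthInstance.maxHeartbeats 200000
set_option maxSynthPendingDepth 6

variable {n : ℕ} [NeZero n] {X : Type*} [TopologicalSpace X]
  [ChartedSpace (EuclideanHalfSpace n) X] [IsManifold (𝓡∂ n) ∞ X]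

/-- The tangent vector with the given coordinates in the chart at `x₀`. -/
def ofChartVec (x₀ x : X) (a : EuclideanSpace ℝ (Fin n)) : TangentSpace (𝓡∂ n) x :=
  (trivializationAt (EuclideanSpace ℝ (Fin n)) (TangentSpace (𝓡∂ n)) x₀).symm x a

theorem mem_baseSet_trivializationAt {x₀ x : X}
    (hx : x ∈ (chartAt (EuclideanHalfSpace n) x₀).source) :
    x ∈ (trivializationAt (EuclideanSpace ℝ (Fin n)) (TangentSpace (𝓡∂ n)) x₀).baseSet := hx

theorem chartVec_ofChartVec {x₀ x : X} (hx : x ∈ (chartAt (EuclideanHalfSpace n) x₀).source)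
    (a : EuclideanSpace ℝ (Fin n)) : chartVec x₀ (ofChartVec x₀ x a) = a :=
  congrArg Prod.snd (Trivialization.apply_mk_symm _ (mem_baseSet_trivializationAt hx) a)

theorem ofChartVec_chartVec {x₀ x : X} (hx : x ∈ (chartAt (EuclideanHalfSpace n) x₀).source)
    (w : TangentSpace (𝓡∂ n) x) : ofChartVec x₀ x (chartVec x₀ w) = w :=
  Trivialization.symm_apply_apply_mk _ (mem_baseSet_trivializationAt hx) w

theorem chartVec_add {x₀ x : X} (hx : x ∈ (chartAt (EuclideanHalfSpace n) x₀).source)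
    (w w' : TangentSpace (𝓡∂ n) x) :
    chartVec x₀ (w + w') = chartVec x₀ w + chartVec x₀ w' :=
  ((trivializationAt (EuclideanSpace ℝ (Fin n)) (TangentSpace (𝓡∂ n)) x₀).linear ℝ
    (mem_baseSet_trivializationAt hx)).map_add w w'

theorem chartVec_smul {x₀ x : X} (hx : x ∈ (chartAt (EuclideanHalfSpace n) x₀).source)
    (c : ℝ) (w : TangentSpace (𝓡∂ n) x) :
    chartVec x₀ (c • w) = c • chartVec x₀ w :=
  ((trivializationAt (EuclideanSpace ℝ (Fin n)) (TangentSpace (𝓡∂ n)) x₀).linear ℝ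
    (mem_baseSet_trivializationAt hx)).map_smul c w

theorem chartVec_eq_tangentCoordChange {x₀ x : X} (w : TangentSpace (𝓡∂ n) x) :
    chartVec x₀ w = tangentCoordChange (𝓡∂ n) x x₀ x w := by
  rw [chartVec, TangentBundle.trivializationAt_apply]
  rfl

/-- A curve in the boundary hyperplane is mapped to a curve in the half space that touches the
hyperplane, so that the derivative of a change of charts preserves the boundary hyperplane. -/
theorem apply_zero_of_hasFDerivWithinAt {ψ : EuclideanSpace ℝ (Fin n) → EuclideanSpace ℝ (Fin n)}
    {L : EuclideanSpace ℝ (Fin n) →L[ℝ] EuclideanSpace ℝ (Fin n)} {p : EuclideanSpace ℝ (Fin n)}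
    (h : HasFDerivWithinAt ψ L (range (𝓡∂ n)) p) (hp : p 0 = 0) (hψp : ψ p 0 = 0)
    (hψ : ∀ r, 0 ≤ ψ r 0) {a : EuclideanSpace ℝ (Fin n)} (ha : a 0 = 0) : L a 0 = 0 := by
  have hline : HasDerivAt (fun t : ℝ ↦ p + t • a) a 0 := by
    simpa using ((hasDerivAt_id (0 : ℝ)).smul_const a).const_add p
  have hmaps : MapsTo (fun t : ℝ ↦ p + t • a) univ (range (𝓡∂ n)) := fun t _ ↦ by
    rw [range_modelWithCornersEuclideanHalfSpace]
    simp [hp, ha]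
  have h' : HasFDerivWithinAt ψ L (range (𝓡∂ n)) ((fun t : ℝ ↦ p + t • a) 0) := by simpa using h
  have h1 := h'.comp_hasDerivWithinAt (0 : ℝ) hline.hasDerivWithinAt hmaps
  rw [hasDerivWithinAt_univ] at h1
  have h2 := (EuclideanSpace.proj (0 : Fin n) :
    EuclideanSpace ℝ (Fin n) →L[ℝ] ℝ).hasFDerivAt.comp_hasDerivAt (0 : ℝ) h1
  refine IsLocalMin.hasDerivAt_eq_zero (Filter.Eventually.of_forall fun t ↦ ?_) h2
  simpa [hψp] using hψ _

omit [IsManifold (𝓡∂ n) ∞ X] in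
theorem extChartAt_apply_zero_nonneg (x₀ x : X) : 0 ≤ extChartAt (𝓡∂ n) x₀ x 0 := by
  have h : extChartAt (𝓡∂ n) x₀ x ∈ range (𝓡∂ n) := ⟨_, rfl⟩
  rwa [range_modelWithCornersEuclideanHalfSpace] at h

/-- Boundary points lie on the boundary hyperplane in every chart. -/
theorem extChartAt_apply_zero_of_mem_boundary {x₀ x : X}
    (hx : x ∈ (chartAt (EuclideanHalfSpace n) x₀).source) (hb : x ∈ (𝓡∂ n).boundary X) :
    extChartAt (𝓡∂ n) x₀ x 0 = 0 := by
  have h := ((𝓡∂ n).isBoundaryPoint_iff_of_mem_atlas (n := ∞) (by simp)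
    (chart_mem_atlas (EuclideanHalfSpace n) x₀) hx).1 hb
  by_contra hne
  have hpos : 0 < extChartAt (𝓡∂ n) x₀ x 0 :=
    lt_of_le_of_ne (extChartAt_apply_zero_nonneg x₀ x) (Ne.symm hne)
  refine h.2 ?_
  have hmem : extChartAt (𝓡∂ n) x₀ x ∈ interior (range (𝓡∂ n)) := by
    rw [interior_range_modelWithCornersEuclideanHalfSpace]
    exact hpos
  have ht : extChartAt (𝓡∂ n) x₀ x ∈ (extChartAt (𝓡∂ n) x₀).target :=
    (extChartAt (𝓡∂ n) x₀).map_source (by rwa [extChartAt_source])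
  have := extChartAt_target_mem_nhdsWithin_of_mem ht
  rw [mem_interior_iff_mem_nhds]
  rwa [nhdsWithin_eq_nhds.2 (mem_interior_iff_mem_nhds.1 hmem)] at this

/-- At a boundary point, the vectors tangent to the boundary are the same in all charts. -/
theorem chartVec_self_apply_zero {x₀ x : X}
    (hx : x ∈ (chartAt (EuclideanHalfSpace n) x₀).source) (hb : x ∈ (𝓡∂ n).boundary X)
    {w : TangentSpace (𝓡∂ n) x} (hw : chartVec x₀ w 0 = 0) : chartVec x w 0 = 0 := by
  have hxx : x ∈ (chartAt (EuclideanHalfSpace n) x).source := mem_chart_source _ x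
  have hs₀ : x ∈ (extChartAt (𝓡∂ n) x₀).source := by rwa [extChartAt_source]
  have hs : x ∈ (extChartAt (𝓡∂ n) x).source := mem_extChartAt_source x
  have hcomp : chartVec x w = tangentCoordChange (𝓡∂ n) x₀ x x (chartVec x₀ w) := by
    rw [chartVec_eq_tangentCoordChange, chartVec_eq_tangentCoordChange]
    exact (tangentCoordChange_comp ⟨⟨hs, hs₀⟩, hs⟩).symm
  rw [hcomp]
  refine apply_zero_of_hasFDerivWithinAt (hasFDerivWithinAt_tangentCoordChange ⟨hs₀, hs⟩)
    (extChartAt_apply_zero_of_mem_boundary hx hb) ?_ (fun r ↦ extChartAt_apply_zero_nonneg x _) hw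
  rw [Function.comp_apply, (extChartAt (𝓡∂ n) x₀).left_inv hs₀]
  exact extChartAt_apply_zero_of_mem_boundary hxx hb

variable {m : ℕ} {U : Set (EuclideanSpace ℝ (Fin m))} {x : EuclideanSpace ℝ (Fin m) → X}

theorem contDiffOn_extChartAt_comp {x₀ : X} {v : ∀ z, TangentSpace (𝓡∂ n) (x z)}
    (hv : ContMDiffOn 𝓘(ℝ, EuclideanSpace ℝ (Fin m)) (𝓡∂ n).tangent ∞
      (fun z ↦ (⟨x z, v z⟩ : TangentBundle (𝓡∂ n) X)) U)
    (hx₀ : ∀ z ∈ U, x z ∈ (chartAt (EuclideanHalfSpace n) x₀).source) :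
    ContDiffOn ℝ ∞ (fun z ↦ extChartAt (𝓡∂ n) x₀ (x z)) U := by
  rw [← contMDiffOn_iff_contDiffOn]
  have hx : ContMDiffOn 𝓘(ℝ, EuclideanSpace ℝ (Fin m)) (𝓡∂ n) ∞ x U :=
    (contMDiff_proj (TangentSpace (𝓡∂ n) : X → Type _)).comp_contMDiffOn hv
  exact (contMDiffOn_extChartAt (I := 𝓡∂ n) (n := ∞) (x := x₀)).comp hx hx₀

theorem contDiffOn_chartVec {x₀ : X} {v : ∀ z, TangentSpace (𝓡∂ n) (x z)}
    (hv : ContMDiffOn 𝓘(ℝ, EuclideanSpace ℝ (Fin m)) (𝓡∂ n).tangent ∞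
      (fun z ↦ (⟨x z, v z⟩ : TangentBundle (𝓡∂ n) X)) U)
    (hx₀ : ∀ z ∈ U, x z ∈ (chartAt (EuclideanHalfSpace n) x₀).source) :
    ContDiffOn ℝ ∞ (fun z ↦ chartVec x₀ (v z)) U := by
  rw [← contMDiffOn_iff_contDiffOn]
  refine (((trivializationAt (EuclideanSpace ℝ (Fin n)) (TangentSpace (𝓡∂ n)) x₀).contMDiffOn_iff
    (IB := 𝓡∂ n) (n := ∞) fun z hz ↦ ?_).1 hv).2
  rw [Trivialization.mem_source]
  exact hx₀ z hz

/-- If the differential of the map `z ↦ (x z, v z)` to the tangent bundle kills `ζ`, then so do the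
differentials of the coordinates of `x` and of `v` in a chart. -/
theorem fderiv_extChartAt_comp_eq_zero {x₀ : X} {v : ∀ z, TangentSpace (𝓡∂ n) (x z)} (hU : IsOpen U)
    (hv : ContMDiffOn 𝓘(ℝ, EuclideanSpace ℝ (Fin m)) (𝓡∂ n).tangent ∞
      (fun z ↦ (⟨x z, v z⟩ : TangentBundle (𝓡∂ n) X)) U)
    (hx₀ : ∀ z ∈ U, x z ∈ (chartAt (EuclideanHalfSpace n) x₀).source)
    {y ζ : EuclideanSpace ℝ (Fin m)} (hy : y ∈ U)
    (hζ : mfderiv 𝓘(ℝ, EuclideanSpace ℝ (Fin m)) (𝓡∂ n).tangent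
      (fun z ↦ (⟨x z, v z⟩ : TangentBundle (𝓡∂ n) X)) y ζ = 0) :
    fderiv ℝ (fun z ↦ extChartAt (𝓡∂ n) x₀ (x z)) y ζ = 0 ∧
      fderiv ℝ (fun z ↦ chartVec x₀ (v z)) y ζ = 0 := by
  have hvy : MDifferentiableAt 𝓘(ℝ, EuclideanSpace ℝ (Fin m)) (𝓡∂ n).tangent
      (fun z ↦ (⟨x z, v z⟩ : TangentBundle (𝓡∂ n) X)) y :=
    (hv.contMDiffAt (hU.mem_nhds hy)).mdifferentiableAt (by simp)
  have key {ρ : TangentBundle (𝓡∂ n) X → EuclideanSpace ℝ (Fin n)}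
      (hρ : MDifferentiableAt (𝓡∂ n).tangent 𝓘(ℝ, EuclideanSpace ℝ (Fin n)) ρ ⟨x y, v y⟩) :
      fderiv ℝ (fun z ↦ ρ ⟨x z, v z⟩) y ζ = 0 := by
    have h := mfderiv_comp y hρ hvy
    rw [mfderiv_eq_fderiv] at h
    have h' := congrArg (fun L : EuclideanSpace ℝ (Fin m) →L[ℝ] EuclideanSpace ℝ (Fin n) ↦ L ζ) h
    refine h'.trans ?_
    refine (congrArg (mfderiv (𝓡∂ n).tangent 𝓘(ℝ, EuclideanSpace ℝ (Fin n)) ρ ⟨x y, v y⟩)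
      hζ).trans ?_
    exact map_zero _
  have hsrc : (⟨x y, v y⟩ : TangentBundle (𝓡∂ n) X) ∈ (trivializationAt
      (EuclideanSpace ℝ (Fin n)) (TangentSpace (𝓡∂ n)) x₀).source := by
    rw [Trivialization.mem_source]
    exact hx₀ y hy
  constructor
  · have h1 : ContMDiffAt (𝓡∂ n) 𝓘(ℝ, EuclideanSpace ℝ (Fin n)) ∞ (extChartAt (𝓡∂ n) x₀) (x y) :=
      contMDiffAt_extChartAt' (hx₀ y hy)
    have h2 : ContMDiffAt (𝓡∂ n).tangent (𝓡∂ n) ∞ (TotalSpace.proj :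
        TangentBundle (𝓡∂ n) X → X) ⟨x y, v y⟩ :=
      contMDiff_proj (TangentSpace (𝓡∂ n) : X → Type _) _
    exact key (ρ := fun w ↦ extChartAt (𝓡∂ n) x₀ w.proj)
      ((h1.comp (⟨x y, v y⟩ : TangentBundle (𝓡∂ n) X) h2).mdifferentiableAt (by simp))
  · have h1 := ((trivializationAt (EuclideanSpace ℝ (Fin n)) (TangentSpace (𝓡∂ n)) x₀).contMDiffOn
      (IB := 𝓡∂ n) (n := ∞)).contMDiffAt (OpenPartialHomeomorph.open_source _ |>.mem_nhds hsrc)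
    exact key (ρ := fun w ↦ (trivializationAt (EuclideanSpace ℝ (Fin n)) (TangentSpace (𝓡∂ n)) x₀
      w).2) ((h1.snd).mdifferentiableAt (by simp))

variable [RiemannianBundle (fun x : X ↦ TangentSpace (𝓡∂ n) x)]

/-- The metric in the chart at `x₀` as a family of continuous bilinear forms. -/
def chartMetric (x₀ : X) (p : EuclideanSpace ℝ (Fin n)) :
    EuclideanSpace ℝ (Fin n) →L[ℝ] EuclideanSpace ℝ (Fin n) →L[ℝ] ℝ :=
  let τ := (trivializationAt (EuclideanSpace ℝ (Fin n)) (TangentSpace (𝓡∂ n)) x₀).symmₗ ℝ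
    ((extChartAt (𝓡∂ n) x₀).symm p)
  LinearMap.toContinuousLinearMap ((LinearMap.toContinuousLinearMap :
    (EuclideanSpace ℝ (Fin n) →ₗ[ℝ] ℝ) ≃ₗ[ℝ] _).toLinearMap ∘ₗ (innerₗ _).compl₁₂ τ τ)

theorem chartMetric_apply {x₀ : X} {p : EuclideanSpace ℝ (Fin n)}
    (hp : p ∈ (extChartAt (𝓡∂ n) x₀).target) (a b : EuclideanSpace ℝ (Fin n)) :
    chartMetric x₀ p a b = metricInChart x₀ p a b := by
  have hb := (extChartAt (𝓡∂ n) x₀).map_target hp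
  rw [extChartAt_source] at hb
  simp only [chartMetric, metricInChart, LinearMap.coe_toContinuousLinearMap', LinearMap.comp_apply,
    LinearEquiv.coe_coe, LinearMap.compl₁₂_apply]
  rw [Trivialization.symmₗ_apply _ (mem_baseSet_trivializationAt hb),
    Trivialization.symmₗ_apply _ (mem_baseSet_trivializationAt hb)]
  rfl

theorem chartMetric_chartVec {x₀ x : X}
    (hx : x ∈ (chartAt (EuclideanHalfSpace n) x₀).source) (w w' : TangentSpace (𝓡∂ n) x) :
    chartMetric x₀ (extChartAt (𝓡∂ n) x₀ x) (chartVec x₀ w) (chartVec x₀ w') = inner ℝ w w' := by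
  have hs : x ∈ (extChartAt (𝓡∂ n) x₀).source := by rwa [extChartAt_source]
  rw [chartMetric_apply ((extChartAt (𝓡∂ n) x₀).map_source hs), metricInChart,
    (extChartAt (𝓡∂ n) x₀).left_inv hs]
  exact congrArg₂ (inner ℝ) (ofChartVec_chartVec hx w) (ofChartVec_chartVec hx w')

variable [IsContMDiffRiemannianBundle (𝓡∂ n) ∞ (EuclideanSpace ℝ (Fin n))
      (fun x : X ↦ TangentSpace (𝓡∂ n) x)]

theorem isSmoothMetric_chartMetric (x₀ : X) :
    IsSmoothMetric (metricInChart x₀) (range (𝓡∂ n)) (extChartAt (𝓡∂ n) x₀).target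
      (chartMetric x₀) where
  subset := extChartAt_target_subset_range x₀
  eventuallyEq p hp := by
    refine nhdsWithin_eq_iff_eventuallyEq.1 (le_antisymm ?_
      (nhdsWithin_mono _ (extChartAt_target_subset_range x₀)))
    exact nhdsWithin_le_iff.2 (extChartAt_target_mem_nhdsWithin_of_mem hp)
  uniqueDiffOn := uniqueDiffOn_extChartAt_target x₀
  apply_eq p hp a b := (chartMetric_apply hp a b).symm
  symm p hp a b := by
    rw [chartMetric_apply hp, chartMetric_apply hp]
    exact real_inner_comm _ _
  contDiffOn := by
    rw [contDiffOn_clm_apply]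
    intro a
    rw [contDiffOn_clm_apply]
    intro b
    have hsec (a : EuclideanSpace ℝ (Fin n)) : ContMDiffOn 𝓘(ℝ, EuclideanSpace ℝ (Fin n))
        (𝓡∂ n).tangent ∞ (fun p ↦ (⟨(extChartAt (𝓡∂ n) x₀).symm p,
          ofChartVec x₀ ((extChartAt (𝓡∂ n) x₀).symm p) a⟩ : TangentBundle (𝓡∂ n) X))
        (extChartAt (𝓡∂ n) x₀).target := by
      have hsrc (p) (hp : p ∈ (extChartAt (𝓡∂ n) x₀).target) :
          (extChartAt (𝓡∂ n) x₀).symm p ∈ (chartAt (EuclideanHalfSpace n) x₀).source := by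
        rw [← extChartAt_source (𝓡∂ n)]
        exact (extChartAt (𝓡∂ n) x₀).map_target hp
      refine ((trivializationAt (EuclideanSpace ℝ (Fin n))
        (TangentSpace (𝓡∂ n)) x₀).contMDiffOn_iff fun p hp ↦ ?_).2
          ⟨contMDiffOn_extChartAt_symm x₀, ?_⟩
      · rw [Trivialization.mem_source]
        exact hsrc p hp
      · exact contMDiffOn_const.congr fun p hp ↦ chartVec_ofChartVec (hsrc p hp) a
    have h := (hsec a).inner_bundle (hsec b)
    rw [contMDiffOn_iff_contDiffOn] at h
    exact h.congr fun p hp ↦ chartMetric_apply hp a b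

end Charts

/-! ### Orthonormal frames and the independence of the frame -/

section Frames

set_option synthInstance.maxHeartbeats 200000
set_option maxSynthPendingDepth 6

theorem curvForm_congr {m n : ℕ} {s : Finset (Fin n)}
    {conn conn' : Fin n → Fin n → EuclideanSpace ℝ (Fin m) →
      StrongDual ℝ (EuclideanSpace ℝ (Fin m))} {y : EuclideanSpace ℝ (Fin m)}
    {A B : Fin n} (hA : A ∈ s) (hB : B ∈ s)
    (h : ∀ C ∈ s, ∀ D ∈ s, conn C D =ᶠ[nhds y] conn' C D) :
    curvForm s conn A B y = curvForm s conn' A B y := by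
  rw [curvForm, curvForm, extD_congr (h A hA B hB)]
  congr 1
  refine Finset.sum_congr rfl fun C hC ↦ ?_
  rw [(h A hA C hC).self_of_nhds, (h C hC B hB).self_of_nhds]

variable {n : ℕ} [NeZero n] {X : Type*} [TopologicalSpace X]
  [ChartedSpace (EuclideanHalfSpace n) X] [IsManifold (𝓡∂ n) ∞ X]
  [RiemannianBundle (fun x : X ↦ TangentSpace (𝓡∂ n) x)]
  {o : TangentOrientation n X} {x₀ : X} {m : ℕ} {U : Set (EuclideanSpace ℝ (Fin m))}
  {x : EuclideanSpace ℝ (Fin m) → X} {v : ∀ z, TangentSpace (𝓡∂ n) (x z)}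
  {e f : Fin n → ∀ z, TangentSpace (𝓡∂ n) (x z)}

/-- The expansion of a tangent vector in an orthonormal frame. -/
theorem IsOrientedFrame.sum_inner_smul {x : X} {e : Fin n → TangentSpace (𝓡∂ n) x}
    (he : IsOrientedFrame o e) (w : TangentSpace (𝓡∂ n) x) :
    ∑ A, (inner ℝ w (e A) : ℝ) • e A = w := by
  obtain ⟨ho, b, hb, -⟩ := he
  have hb' : Orthonormal ℝ b := by rwa [show (b : Fin n → TangentSpace (𝓡∂ n) x) = e from funext hb]
  have h := (b.toOrthonormalBasis hb').sum_repr' w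
  simp only [Module.Basis.coe_toOrthonormalBasis, hb] at h
  conv_rhs => rw [← h]
  exact Finset.sum_congr rfl fun A _ ↦ by rw [real_inner_comm]

/-- The matrix of the change between two positively oriented orthonormal frames has
determinant one. -/
theorem det_inner_eq_one {x : X} {e f : Fin n → TangentSpace (𝓡∂ n) x}
    (hf : IsOrientedFrame o f) (he : IsOrientedFrame o e) :
    (Matrix.of fun A B ↦ (inner ℝ (f A) (e B) : ℝ)).det = 1 := by
  have hexp := he.sum_inner_smul
  obtain ⟨hfo, b', hb', hor'⟩ := hf
  obtain ⟨heo, b, hb, hor⟩ := he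
  have hpos := (b.orientation_eq_iff_det_pos b').1 (hor.trans hor'.symm)
  have hmat : b.toMatrix b' = (Matrix.of fun A B ↦ (inner ℝ (f A) (e B) : ℝ)).transpose := by
    ext i j
    rw [Module.Basis.toMatrix_apply, hb' j]
    conv_lhs => rw [← hexp (f j)]
    simp [← hb, Finsupp.single_apply]
  rw [Module.Basis.det_apply, hmat, Matrix.det_transpose] at hpos
  have hmul : (Matrix.of fun A B ↦ (inner ℝ (f A) (e B) : ℝ)) *
      (Matrix.of fun A B ↦ (inner ℝ (f A) (e B) : ℝ)).transpose = 1 := by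
    ext i j
    rw [Matrix.mul_apply, Matrix.one_apply, ← orthonormal_iff_ite.1 hfo i j]
    conv_rhs => rw [← hexp (f j), inner_sum]
    simp [inner_smul_right, mul_comm]
  -- an orthogonal matrix with positive determinant
  have hsq := congrArg Matrix.det hmul
  rw [Matrix.det_mul, Matrix.det_transpose, Matrix.det_one] at hsq
  nlinarith

/-- A vector is the sum of its normal and its tangential part, with coefficients the cosine and
the sine of its angle with the normal. -/
theorem eq_cos_smul_add_sin_smul {x : X} {w : TangentSpace (𝓡∂ n) x} (hw : ‖w‖ = 1)
    (hν : ‖(outwardNormal x : TangentSpace (𝓡∂ n) x)‖ = 1) (hp : ‖equatorProj w‖ = 1)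
    (hνp : (inner ℝ (outwardNormal x) (equatorProj w) : ℝ) = 0) :
    w = Real.cos (normalAngle w) • outwardNormal x + Real.sin (normalAngle w) • equatorProj w := by
  have hcos : Real.cos (normalAngle w) = inner ℝ w (outwardNormal x) := by
    rw [normalAngle, InnerProductGeometry.cos_angle, hw, hν]; simp
  have ht : ‖tangentialPart w‖ ≠ 0 := by
    intro h
    rw [equatorProj, h] at hp
    simp at hp
  have htp : ‖tangentialPart w‖ • equatorProj w = tangentialPart w := by
    rw [equatorProj, smul_smul, mul_inv_cancel₀ ht, one_smul]
  have hdec : w = Real.cos (normalAngle w) • outwardNormal x +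
      ‖tangentialPart w‖ • equatorProj w := by
    rw [htp, hcos, tangentialPart]; abel
  have hsin : Real.sin (normalAngle w) = ‖tangentialPart w‖ := by
    have h1 : ‖w‖ ^ 2 = Real.cos (normalAngle w) ^ 2 + ‖tangentialPart w‖ ^ 2 := by
      conv_lhs => rw [hdec]
      rw [norm_add_sq_real, norm_smul, norm_smul, inner_smul_left, inner_smul_right, hνp, hν, hp]
      simp
    rw [hw] at h1
    have h2 := Real.sin_sq_add_cos_sq (normalAngle w)
    refine (sq_eq_sq₀ (InnerProductGeometry.sin_angle_nonneg _ _) (norm_nonneg _)).1 ?_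
    change Real.sin (normalAngle w) ^ 2 = _
    linarith
  rw [hsin]
  exact hdec

/-- A positively oriented orthonormal frame in a chart. -/
theorem IsOrientedFrameAlong.isOrthoFrame (he : IsOrientedFrameAlong o U e)
    (hx₀ : ∀ z ∈ U, x z ∈ (chartAt (EuclideanHalfSpace n) x₀).source) :
    IsOrthoFrame U (fun z ↦ chartMetric x₀ (extChartAt (𝓡∂ n) x₀ (x z)))
      (fun A z ↦ chartVec x₀ (e A z)) where
  contDiffOn A := contDiffOn_chartVec (he.smooth A) hx₀
  ortho z hz A B := by
    rw [chartMetric_chartVec (hx₀ z hz)]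
    exact orthonormal_iff_ite.1 (he.oriented z hz).1 A B
  expand z hz w := by
    have h := (he.oriented z hz).sum_inner_smul (ofChartVec x₀ (x z) w)
    have hL : IsLinearMap ℝ (chartVec x₀ : TangentSpace (𝓡∂ n) (x z) → _) :=
      ⟨chartVec_add (hx₀ z hz), chartVec_smul (hx₀ z hz)⟩
    have h' := congrArg hL.mk' h
    rw [map_sum] at h'
    simp only [map_smul, IsLinearMap.mk'_apply, chartVec_ofChartVec (hx₀ z hz)] at h'
    conv_rhs => rw [← h']
    refine Finset.sum_congr rfl fun B _ ↦ ?_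
    congr 1
    conv_lhs => rw [← chartVec_ofChartVec (hx₀ z hz) w]
    exact chartMetric_chartVec (hx₀ z hz) _ _

/-- The form `Φ_k` as a Berezin integral. -/
theorem PhiK_eq_berezin (f : Fin n → ∀ z, TangentSpace (𝓡∂ n) (x z)) {k : ℕ} (hk : 2 * k < n)
    (y : EuclideanSpace ℝ (Fin m)) :
    PhiK x₀ f v k y = berezin _ n ((1 ⊗ₜ ExteriorAlgebra.ι ℝ fun A ↦ uCoord f v A y) *
      oddSum (fun A ↦ ExteriorAlgebra.ι ℝ (thetaForm x₀ f v A y)) ^ (n - 2 * k - 1) *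
        evenSum (fun A B ↦ OmegaX x₀ f A B y) ^ k) := by
  rw [berezin_odd_odd_even _ _ _ (by omega), PhiK, show n - 2 * k - 1 + 1 = n - 2 * k by omega]
  rfl

/-- The form `Φ^M(i, j)` as a Berezin integral. -/
theorem PhiM_eq_berezin (hn : 3 ≤ n) (e : Fin n → ∀ z, TangentSpace (𝓡∂ n) (x z)) {i j : ℕ}
    (hij : 2 * i + j ≤ n - 2) (y : EuclideanSpace ℝ (Fin m)) :
    PhiM x₀ e i j y = berezin _ (n - 2)
      (oddSum (fun s ↦ ExteriorAlgebra.ι ℝ (omegaX x₀ e 0 (midEmb n s) y)) ^ (n - 2 * i - j - 2) *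
        evenSum (fun s t ↦ OmegaM x₀ e (midEmb n s) (midEmb n t) y) ^ i *
        oddSum (fun s ↦ ExteriorAlgebra.ι ℝ (omegaX x₀ e (midEmb n s) (lastIndex n) y)) ^ j) := by
  have : NeZero (n - 2) := ⟨by omega⟩
  have hmid (α : Equiv.Perm (Fin (n - 2))) (l : ℕ) (hl : l < n - 2) :
      midIndex n α l = midEmb n (seqExt α l) := by
    rw [midIndex, dif_pos hl, seqExt, dif_pos hl]
    rfl
  rw [berezin_odd_even_odd _ _ _ (by omega), PhiM]
  refine Finset.sum_congr rfl fun α _ ↦ ?_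
  congr 2
  · congr 2
    · refine List.map_congr_left fun l hl ↦ ?_
      have := List.mem_range.1 hl
      rw [hmid α l (by omega)]
      rfl
    · refine List.map_congr_left fun l hl ↦ ?_
      have := List.mem_range.1 hl
      rw [hmid α _ (by omega), hmid α _ (by omega)]
  · congr 1
    refine List.map_congr_left fun l hl ↦ ?_
    have := List.mem_range.1 hl
    rw [hmid α _ (by omega), show n - j - 2 + l = n - 2 * i - j - 2 + 2 * i + l by omega]
    rfl

variable [IsContMDiffRiemannianBundle (𝓡∂ n) ∞ (EuclideanSpace ℝ (Fin n))
      (fun x : X ↦ TangentSpace (𝓡∂ n) x)]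

/-- The coefficients of the pullback to an open subset of `ℝᵐ` of the Levi-Civita connection, in
the chart at `x₀`. -/
abbrev connAlong (x₀ : X) (x : EuclideanSpace ℝ (Fin m) → X) :
    EuclideanSpace ℝ (Fin m) → EuclideanSpace ℝ (Fin m) →L[ℝ] EuclideanSpace ℝ (Fin n) →L[ℝ]
      EuclideanSpace ℝ (Fin n) →L[ℝ] ℝ :=
  pullbackConn (extChartAt (𝓡∂ n) x₀).target (chartMetric x₀) fun z ↦ extChartAt (𝓡∂ n) x₀ (x z)

omit [RiemannianBundle (fun x : X ↦ TangentSpace (𝓡∂ n) x)] [IsManifold (𝓡∂ n) ∞ X]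
  [IsContMDiffRiemannianBundle (𝓡∂ n) ∞ (EuclideanSpace ℝ (Fin n))
      (fun x : X ↦ TangentSpace (𝓡∂ n) x)] in
theorem mapsTo_extChartAt_target (hx₀ : ∀ z ∈ U, x z ∈ (chartAt (EuclideanHalfSpace n) x₀).source) :
    MapsTo (fun z ↦ extChartAt (𝓡∂ n) x₀ (x z)) U (extChartAt (𝓡∂ n) x₀).target := fun z hz ↦
  (extChartAt (𝓡∂ n) x₀).map_source (by rw [extChartAt_source]; exact hx₀ z hz)

theorem omegaX_eq_covForm (hx₀ : ∀ z ∈ U, x z ∈ (chartAt (EuclideanHalfSpace n) x₀).source)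
    {z : EuclideanSpace ℝ (Fin m)} (hz : z ∈ U) (e : Fin n → ∀ z, TangentSpace (𝓡∂ n) (x z))
    (A B : Fin n) : omegaX x₀ e A B z =
      covForm (fun z ↦ chartMetric x₀ (extChartAt (𝓡∂ n) x₀ (x z))) (connAlong x₀ x)
        (fun z ↦ chartVec x₀ (e A z)) (fun z ↦ chartVec x₀ (e B z)) z :=
  (isSmoothMetric_chartMetric x₀).connForm_eq (mapsTo_extChartAt_target hx₀) _ _ hz

section

variable (hU : IsOpen U)
  (hv : ContMDiffOn 𝓘(ℝ, EuclideanSpace ℝ (Fin m)) (𝓡∂ n).tangent ∞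
      (fun z ↦ (⟨x z, v z⟩ : TangentBundle (𝓡∂ n) X)) U)
  (hx₀ : ∀ z ∈ U, x z ∈ (chartAt (EuclideanHalfSpace n) x₀).source)

include hU hv hx₀

theorem isMetricConnection_connAlong :
    IsMetricConnection U (fun z ↦ chartMetric x₀ (extChartAt (𝓡∂ n) x₀ (x z)))
      (connAlong x₀ x) :=
  (isSmoothMetric_chartMetric x₀).isMetricConnection hU (contDiffOn_extChartAt_comp hv hx₀)
    (mapsTo_extChartAt_target hx₀)

omit hv in
theorem OmegaX_eq_curvForm {y : EuclideanSpace ℝ (Fin m)} (hy : y ∈ U)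
    (e : Fin n → ∀ z, TangentSpace (𝓡∂ n) (x z)) (A B : Fin n) :
    OmegaX x₀ e A B y = curvForm Finset.univ (fun A B ↦
      covForm (fun z ↦ chartMetric x₀ (extChartAt (𝓡∂ n) x₀ (x z))) (connAlong x₀ x)
        (fun z ↦ chartVec x₀ (e A z)) (fun z ↦ chartVec x₀ (e B z))) A B y := by
  refine curvForm_congr (Finset.mem_univ A) (Finset.mem_univ B) fun C _ D _ ↦ ?_
  filter_upwards [hU.mem_nhds hy] with z hz using omegaX_eq_covForm hx₀ hz e C D

omit hv [IsContMDiffRiemannianBundle (𝓡∂ n) ∞ (EuclideanSpace ℝ (Fin n))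
      (fun x : X ↦ TangentSpace (𝓡∂ n) x)] in
theorem uCoord_eventuallyEq {y : EuclideanSpace ℝ (Fin m)} (hy : y ∈ U)
    (e : Fin n → ∀ z, TangentSpace (𝓡∂ n) (x z)) (A : Fin n) :
    uCoord e v A =ᶠ[nhds y] fun z ↦ chartMetric x₀ (extChartAt (𝓡∂ n) x₀ (x z))
      (chartVec x₀ (v z)) (chartVec x₀ (e A z)) := by
  filter_upwards [hU.mem_nhds hy] with z hz
  rw [chartMetric_chartVec (hx₀ z hz), uCoord]

/-- The form `θ_A` is `⟨∇v, e_A⟩`; in particular it is tensorial in `e_A`. -/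
theorem thetaForm_eq_covForm (he : IsOrientedFrameAlong o U e) {y : EuclideanSpace ℝ (Fin m)}
    (hy : y ∈ U) (A : Fin n) : thetaForm x₀ e v A y =
      covForm (fun z ↦ chartMetric x₀ (extChartAt (𝓡∂ n) x₀ (x z))) (connAlong x₀ x)
        (fun z ↦ chartVec x₀ (v z)) (fun z ↦ chartVec x₀ (e A z)) y := by
  rw [← (isMetricConnection_connAlong hU hv hx₀).fderiv_add_sum_eq_covForm (he.isOrthoFrame hx₀)
    (contDiffOn_chartVec hv hx₀) hy, thetaForm, (uCoord_eventuallyEq hU hx₀ hy e A).fderiv_eq]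
  congr 1
  refine Finset.sum_congr rfl fun B _ ↦ ?_
  rw [(uCoord_eventuallyEq hU hx₀ hy e B).self_of_nhds, omegaX_eq_covForm hx₀ hy]

/-- The forms `Φ_k` do not depend on the choice of the frame: the components `u_A`, `θ_A` and `Ω_AB`
in two frames are related by the orthogonal matrix `R` of the change of frame, so that the
Berezin integrals differ by the factor `det R = 1`. -/
theorem PhiK_eq_of_frames (he : IsOrientedFrameAlong o U e) (hf : IsOrientedFrameAlong o U f)
    {k : ℕ} (hk : 2 * k < n) {y : EuclideanSpace ℝ (Fin m)} (hy : y ∈ U) :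
    PhiK x₀ f v k y = PhiK x₀ e v k y := by
  have H := isMetricConnection_connAlong hU hv hx₀
  have hE := he.isOrthoFrame hx₀
  have hF := hf.isOrthoFrame hx₀
  let R : Matrix (Fin n) (Fin n) ℝ := Matrix.of fun A B ↦ inner ℝ (f A y) (e B y)
  have hdet : R.det = 1 := det_inner_eq_one (hf.oriented y hy) (he.oriented y hy)
  have hR (A B) : R A B = chartMetric x₀ (extChartAt (𝓡∂ n) x₀ (x y)) (chartVec x₀ (f A y))
      (chartVec x₀ (e B y)) := (chartMetric_chartVec (hx₀ y hy) _ _).symm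
  have hu : (fun A ↦ uCoord f v A y) = R.mulVec fun A ↦ uCoord e v A y := by
    ext A
    simp only [Matrix.mulVec, dotProduct, uCoord, R, Matrix.of_apply]
    conv_lhs => rw [← (he.oriented y hy).sum_inner_smul (f A y), inner_sum]
    simp [inner_smul_right]
  have hθ (A) : thetaForm x₀ f v A y = ∑ B, R A B • thetaForm x₀ e v B y := by
    rw [thetaForm_eq_covForm hU hv hx₀ hf hy, ← IsMetricConnection.covForm_expand hE _ _ hy]
    exact Finset.sum_congr rfl fun B _ ↦ by rw [thetaForm_eq_covForm hU hv hx₀ he hy, hR]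
  have hRR (A B) : ∑ C, R A C * R B C = if A = B then 1 else 0 := by
    rw [← orthonormal_iff_ite.1 (hf.oriented y hy).1 A B]
    conv_rhs => rw [← (he.oriented y hy).sum_inner_smul (f B y), inner_sum]
    simp [R, inner_smul_right, mul_comm]
  have hΩ (A B) : OmegaX x₀ f A B y = ∑ C, ∑ D, (R A C * R B D) • OmegaX x₀ e C D y := by
    have h (D) : ∑ B, R B D • OmegaX x₀ f A B y = ∑ C, R A C • OmegaX x₀ e C D y := by
      simp only [OmegaX_eq_curvForm hU hx₀ hy, hR]
      exact H.curvForm_change hE hF y hy A D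
    calc OmegaX x₀ f A B y = ∑ B', (∑ D, R B D * R B' D) • OmegaX x₀ f A B' y := by
          simp [hRR]
      _ = ∑ D, R B D • ∑ B', R B' D • OmegaX x₀ f A B' y := by
          simp only [Finset.sum_smul, Finset.smul_sum, smul_smul]
          exact Finset.sum_comm
      _ = _ := by
          simp only [h, Finset.smul_sum, smul_smul]
          rw [Finset.sum_comm]
          simp only [mul_comm]
  have hsubst : (1 ⊗ₜ ExteriorAlgebra.ι ℝ fun A ↦ uCoord f v A y) *
      oddSum (fun A ↦ ExteriorAlgebra.ι ℝ (thetaForm x₀ f v A y)) ^ (n - 2 * k - 1) *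
        evenSum (fun A B ↦ OmegaX x₀ f A B y) ^ k =
      substFrame _ R ((1 ⊗ₜ ExteriorAlgebra.ι ℝ fun A ↦ uCoord e v A y) *
      oddSum (fun A ↦ ExteriorAlgebra.ι ℝ (thetaForm x₀ e v A y)) ^ (n - 2 * k - 1) *
        evenSum (fun A B ↦ OmegaX x₀ e A B y) ^ k) := by
    simp only [map_mul, map_pow, substFrame_tmul_ι, substFrame_oddSum, substFrame_evenSum, hu, hθ,
      hΩ, map_sum, map_smul]
  rw [PhiK_eq_berezin f hk, PhiK_eq_berezin e hk, hsubst, berezin_substFrame, hdet, one_smul]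

end

end Frames

/-! ### Adapted frames -/

section Adapted

set_option synthInstance.maxHeartbeats 200000
set_option maxSynthPendingDepth 6

variable {n : ℕ} [NeZero n] {X : Type*} [TopologicalSpace X]
  [ChartedSpace (EuclideanHalfSpace n) X] [IsManifold (𝓡∂ n) ∞ X]
  [RiemannianBundle (fun x : X ↦ TangentSpace (𝓡∂ n) x)]
  {o : TangentOrientation n X} {x₀ : X} {m : ℕ} {U : Set (EuclideanSpace ℝ (Fin m))}
  {x : EuclideanSpace ℝ (Fin m) → X} {v : ∀ z, TangentSpace (𝓡∂ n) (x z)}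
  {e : Fin n → ∀ z, TangentSpace (𝓡∂ n) (x z)}

/-- The value of `outwardNormal` is zero where no outward unit normal exists. -/
theorem isOutwardUnitNormal_outwardNormal {x : X}
    (h : (outwardNormal x : TangentSpace (𝓡∂ n) x) ≠ 0) :
    IsOutwardUnitNormal x (outwardNormal x : TangentSpace (𝓡∂ n) x) := by
  by_cases hex : ∃ ν : TangentSpace (𝓡∂ n) x, IsOutwardUnitNormal x ν
  · rw [outwardNormal, dif_pos hex]
    exact hex.choose_spec
  · exact absurd (dif_neg hex) h

/-- An adapted frame along the map `z ↦ v z` into the unit tangent vectors at boundary points in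
the domain of the chart at `x₀`: its first vector is the outward normal and its last vector is
the normalized projection of `v` to the boundary. -/
structure IsAdaptedFrame (o : TangentOrientation n X) (x₀ : X) (U : Set (EuclideanSpace ℝ (Fin m)))
    (v : ∀ z, TangentSpace (𝓡∂ n) (x z)) (e : Fin n → ∀ z, TangentSpace (𝓡∂ n) (x z)) : Prop where
  isOpen : IsOpen U
  mem_source : ∀ z ∈ U, x z ∈ (chartAt (EuclideanHalfSpace n) x₀).source
  mem_boundary : ∀ z ∈ U, x z ∈ (𝓡∂ n).boundary X
  norm_eq_one : ∀ z ∈ U, ‖v z‖ = 1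
  frame : IsOrientedFrameAlong o U e
  first : ∀ z ∈ U, e 0 z = outwardNormal (x z)
  last : ∀ z ∈ U, e (lastIndex n) z = equatorProj (v z)

namespace IsAdaptedFrame

variable (H : IsAdaptedFrame o x₀ U v e)

include H

theorem inner_first_eq_zero {z : EuclideanSpace ℝ (Fin m)} (hz : z ∈ U)
    {w : TangentSpace (𝓡∂ n) (x z)} (hw : chartVec x₀ w 0 = 0) : inner ℝ (e 0 z) w = 0 := by
  have hne : (outwardNormal (x z) : TangentSpace (𝓡∂ n) (x z)) ≠ 0 := by
    rw [← H.first z hz]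
    exact (H.frame.oriented z hz).1.ne_zero 0
  rw [H.first z hz]
  exact (isOutwardUnitNormal_outwardNormal hne).2.2 w
    (chartVec_self_apply_zero (H.mem_source z hz) (H.mem_boundary z hz) hw)

/-- The vectors of an adapted frame other than the first are tangent to the boundary. -/
theorem chartVec_apply_zero {z : EuclideanSpace ℝ (Fin m)} (hz : z ∈ U) {A : Fin n} (hA : A ≠ 0) :
    chartVec x₀ (e A z) 0 = 0 := by
  have ho := orthonormal_iff_ite.1 (H.frame.oriented z hz).1
  have hc : chartVec x₀ (e 0 z) 0 ≠ 0 := fun h ↦ by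
    have h1 := H.inner_first_eq_zero hz h
    have h2 := ho 0 0
    simp only [if_true] at h2
    exact zero_ne_one (h1.symm.trans h2)
  -- the component of `e_A` tangent to the boundary along `e_1` is orthogonal to `e_1`
  have h := H.inner_first_eq_zero hz
    (w := e A z - (chartVec x₀ (e A z) 0 / chartVec x₀ (e 0 z) 0) • e 0 z) (by
      rw [sub_eq_add_neg, ← neg_smul, chartVec_add (H.mem_source z hz),
        chartVec_smul (H.mem_source z hz)]
      simp [hc])
  rw [inner_sub_right, inner_smul_right] at h
  have h1 := ho 0 A
  have h2 := ho 0 0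
  rw [if_neg hA.symm] at h1
  simp only [if_true] at h2
  rw [h1, h2] at h
  simpa [hc] using h

theorem eq_cos_smul_add_sin_smul (hn : 3 ≤ n) {z : EuclideanSpace ℝ (Fin m)} (hz : z ∈ U) :
    v z = Real.cos (normalAngle (v z)) • e 0 z
      + Real.sin (normalAngle (v z)) • e (lastIndex n) z := by
  have ho := (H.frame.oriented z hz).1
  rw [H.first z hz, H.last z hz]
  refine _root_.eq_cos_smul_add_sin_smul (H.norm_eq_one z hz) ?_ ?_ ?_
  · rw [← H.first z hz]; exact ho.1 0
  · rw [← H.last z hz]; exact ho.1 _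
  · rw [← H.first z hz, ← H.last z hz]; exact ho.2 (zero_ne_lastIndex (by omega))

theorem uCoord_zero (hn : 3 ≤ n) {z : EuclideanSpace ℝ (Fin m)} (hz : z ∈ U) :
    uCoord e v 0 z = Real.cos (normalAngle (v z)) := by
  have ho := orthonormal_iff_ite.1 (H.frame.oriented z hz).1
  rw [uCoord]
  conv_lhs => rw [H.eq_cos_smul_add_sin_smul hn hz]
  rw [inner_add_left, inner_smul_left, inner_smul_left, ho, ho, if_pos rfl,
    if_neg (zero_ne_lastIndex (by omega)).symm]
  simp

theorem uCoord_last (hn : 3 ≤ n) {z : EuclideanSpace ℝ (Fin m)} (hz : z ∈ U) :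
    uCoord e v (lastIndex n) z = Real.sin (normalAngle (v z)) := by
  have ho := orthonormal_iff_ite.1 (H.frame.oriented z hz).1
  rw [uCoord]
  conv_lhs => rw [H.eq_cos_smul_add_sin_smul hn hz]
  rw [inner_add_left, inner_smul_left, inner_smul_left, ho, ho, if_pos rfl,
    if_neg (zero_ne_lastIndex (by omega))]
  simp

theorem uCoord_midEmb (hn : 3 ≤ n) {z : EuclideanSpace ℝ (Fin m)} (hz : z ∈ U) (s : Fin (n - 2)) :
    uCoord e v (midEmb n s) z = 0 := by
  have ho := orthonormal_iff_ite.1 (H.frame.oriented z hz).1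
  rw [uCoord]
  conv_lhs => rw [H.eq_cos_smul_add_sin_smul hn hz]
  rw [inner_add_left, inner_smul_left, inner_smul_left, ho, ho, if_neg (midEmb_ne_zero s).symm,
    if_neg (midEmb_ne_lastIndex s).symm]
  simp

theorem fderiv_uCoord_midEmb (hn : 3 ≤ n) {y : EuclideanSpace ℝ (Fin m)} (hy : y ∈ U)
    (s : Fin (n - 2)) :
    fderiv ℝ (uCoord e v (midEmb n s)) y = 0 := by
  have h : uCoord e v (midEmb n s) =ᶠ[nhds y] fun _ ↦ (0 : ℝ) := by
    filter_upwards [H.isOpen.mem_nhds hy] with z hz using H.uCoord_midEmb hn hz s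
  rw [h.fderiv_eq, fderiv_fun_const]
  rfl

theorem thetaForm_eq (hn : 3 ≤ n) {y : EuclideanSpace ℝ (Fin m)} (hy : y ∈ U) (A : Fin n) :
    thetaForm x₀ e v A y = fderiv ℝ (uCoord e v A) y +
      (Real.cos (normalAngle (v y)) • omegaX x₀ e 0 A y +
        Real.sin (normalAngle (v y)) • omegaX x₀ e (lastIndex n) A y) := by
  rw [thetaForm, Fintype.sum_eq_add 0 (lastIndex n) (zero_ne_lastIndex (by omega)),
    H.uCoord_zero hn hy, H.uCoord_last hn hy]
  rintro B ⟨h0, hl⟩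
  obtain ⟨s, rfl⟩ := exists_midEmb_eq h0 hl
  rw [H.uCoord_midEmb hn hy, zero_smul]

variable [IsContMDiffRiemannianBundle (𝓡∂ n) ∞ (EuclideanSpace ℝ (Fin n))
      (fun x : X ↦ TangentSpace (𝓡∂ n) x)]

theorem isMetricConnection : IsMetricConnection U
    (fun z ↦ chartMetric x₀ (extChartAt (𝓡∂ n) x₀ (x z))) (connAlong x₀ x) :=
  isMetricConnection_connAlong H.isOpen (H.frame.smooth 0) H.mem_source

theorem omegaX_antisymm (A B : Fin n) {z : EuclideanSpace ℝ (Fin m)} (hz : z ∈ U) :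
    omegaX x₀ e A B z = -omegaX x₀ e B A z := by
  rw [omegaX_eq_covForm H.mem_source hz, omegaX_eq_covForm H.mem_source hz]
  exact H.isMetricConnection.covForm_antisymm (H.frame.isOrthoFrame H.mem_source) A B hz

/-- Between vectors tangent to the boundary, the connection forms of the manifold and of its
boundary agree. -/
theorem omegaM_eq_omegaX {A B : Fin n} (hA : A ≠ 0) (hB : B ≠ 0) {z : EuclideanSpace ℝ (Fin m)}
    (hz : z ∈ U) : omegaM x₀ e A B z = omegaX x₀ e A B z := by
  have hUz := H.isOpen.mem_nhds hz
  refine connForm_boundary (isSmoothMetric_chartMetric x₀) (fun p hp ↦ ?_)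
    (mapsTo_extChartAt_target H.mem_source hz)
    ((contDiffOn_extChartAt_comp (H.frame.smooth 0) H.mem_source).differentiableAt_of_isOpen
      H.isOpen hz)
    ((contDiffOn_chartVec (H.frame.smooth A) H.mem_source).differentiableAt_of_isOpen H.isOpen hz)
    ?_ ?_ (H.chartVec_apply_zero hz hB)
  · rw [range_modelWithCornersEuclideanHalfSpace]
    exact hp.ge
  · filter_upwards [hUz] with w hw using
      extChartAt_apply_zero_of_mem_boundary (H.mem_source w hw) (H.mem_boundary w hw)
  · filter_upwards [hUz] with w hw using H.chartVec_apply_zero hw hA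

/-- The Gauss equation. -/
theorem OmegaX_eq_OmegaM_add {A B : Fin n} (hA : A ≠ 0) (hB : B ≠ 0)
    {y : EuclideanSpace ℝ (Fin m)} (hy : y ∈ U) :
    OmegaX x₀ e A B y = OmegaM x₀ e A B y +
      toForm (omegaX x₀ e 0 A y) * toForm (omegaX x₀ e 0 B y) := by
  have hM : OmegaM x₀ e A B y = curvForm (Finset.univ.erase 0) (omegaX x₀ e) A B y := by
    refine curvForm_congr (by simp [hA]) (by simp [hB]) fun C hC D hD ↦ ?_
    filter_upwards [H.isOpen.mem_nhds hy] with z hz using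
      H.omegaM_eq_omegaX (Finset.ne_of_mem_erase hC) (Finset.ne_of_mem_erase hD) hz
  rw [hM, OmegaX, curvForm, curvForm, ← Finset.add_sum_erase _ _ (Finset.mem_univ 0),
    H.omegaX_antisymm A 0 hy, toForm, map_neg, neg_mul]
  simp only [toForm]
  abel

variable {y ζ : EuclideanSpace ℝ (Fin m)} (hy : y ∈ U) (hζ : LiftsAngleField v y ζ)

include hy hζ

omit [IsContMDiffRiemannianBundle (𝓡∂ n) ∞ (EuclideanSpace ℝ (Fin n))
      (fun x : X ↦ TangentSpace (𝓡∂ n) x)] in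
/-- Along `∂/∂φ` the base point does not move, and the last vector of the frame is constant. -/
theorem fderiv_eq_zero : fderiv ℝ (fun z ↦ extChartAt (𝓡∂ n) x₀ (x z)) y ζ = 0 ∧
    fderiv ℝ (fun z ↦ chartVec x₀ (e (lastIndex n) z)) y ζ = 0 := by
  have hp : ContMDiffOn 𝓘(ℝ, EuclideanSpace ℝ (Fin m)) (𝓡∂ n).tangent ∞
      (fun z ↦ (⟨x z, equatorProj (v z)⟩ : TangentBundle (𝓡∂ n) X)) U :=
    (H.frame.smooth (lastIndex n)).congr fun z hz ↦ by rw [H.last z hz]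
  have h : (fun z ↦ chartVec x₀ (e (lastIndex n) z)) =ᶠ[nhds y]
      fun z ↦ chartVec x₀ (equatorProj (v z)) := by
    filter_upwards [H.isOpen.mem_nhds hy] with z hz
    rw [H.last z hz]
  rw [h.fderiv_eq]
  exact fderiv_extChartAt_comp_eq_zero H.isOpen hp H.mem_source hy hζ.equator

omit [IsContMDiffRiemannianBundle (𝓡∂ n) ∞ (EuclideanSpace ℝ (Fin n))
      (fun x : X ↦ TangentSpace (𝓡∂ n) x)] in
theorem connAlong_apply_eq_zero : connAlong (n := n) x₀ x y ζ = 0 := by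
  rw [connAlong, pullbackConn, ContinuousLinearMap.comp_apply, (H.fderiv_eq_zero hy hζ).1, map_zero]

theorem contraction_OmegaX (A B : Fin n) :
    contraction (evalVec ζ) (OmegaX x₀ e A B y) = 0 := by
  rw [OmegaX_eq_curvForm H.isOpen H.mem_source hy]
  exact H.isMetricConnection.contraction_curvForm_eq_zero (H.frame.isOrthoFrame H.mem_source) hy
    (H.connAlong_apply_eq_zero hy hζ)
    ((isSmoothMetric_chartMetric x₀).fderiv_pullbackConn_swap H.isOpen
      (contDiffOn_extChartAt_comp (H.frame.smooth 0) H.mem_source)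
      (mapsTo_extChartAt_target H.mem_source) hy (H.fderiv_eq_zero hy hζ).1) A B

/-- Along `∂/∂φ` the base point is fixed and the last vector of the frame is constant, while the
vectors other than the first stay tangent to the boundary and hence orthogonal to the first. -/
theorem omegaX_apply_eq_zero {A : Fin n} (hA : A = 0 ∨ A = lastIndex n) (B : Fin n) :
    omegaX x₀ e A B y ζ = 0 := by
  have hω (A B : Fin n) : omegaX x₀ e A B y ζ = chartMetric x₀ (extChartAt (𝓡∂ n) x₀ (x y))
      (fderiv ℝ (fun z ↦ chartVec x₀ (e A z)) y ζ) (chartVec x₀ (e B y)) := by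
    rw [omegaX_eq_covForm H.mem_source hy, covForm_apply, H.connAlong_apply_eq_zero hy hζ]
    simp
  rcases hA with rfl | rfl
  · rw [H.omegaX_antisymm 0 B hy, _root_.neg_apply, neg_eq_zero]
    rcases eq_or_ne B 0 with rfl | hB
    · have h := congrArg (fun L ↦ L ζ) (H.omegaX_antisymm 0 0 hy)
      simp only [_root_.neg_apply] at h
      linarith
    · have h0 := fderiv_apply_zero_of_eventually
        ((contDiffOn_chartVec (H.frame.smooth B) H.mem_source).differentiableAt_of_isOpen
          H.isOpen hy) (by
          filter_upwards [H.isOpen.mem_nhds hy] with w hw using H.chartVec_apply_zero hw hB) ζ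
      rw [hω, ← chartVec_ofChartVec (H.mem_source y hy) (fderiv ℝ _ y ζ),
        chartMetric_chartVec (H.mem_source y hy), real_inner_comm]
      refine H.inner_first_eq_zero hy ?_
      rwa [chartVec_ofChartVec (H.mem_source y hy)]
  · rw [hω, (H.fderiv_eq_zero hy hζ).2]
    simp

theorem thetaForm_apply (hn : 3 ≤ n) (A : Fin n) :
    thetaForm x₀ e v A y ζ = fderiv ℝ (uCoord e v A) y ζ := by
  rw [H.thetaForm_eq hn hy]
  simp [H.omegaX_apply_eq_zero hy hζ]

omit H hy [IsContMDiffRiemannianBundle (𝓡∂ n) ∞ (EuclideanSpace ℝ (Fin n))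
      (fun x : X ↦ TangentSpace (𝓡∂ n) x)] in
/-- The angle is differentiable where its derivative is one, as the derivative of a function that
is not differentiable is zero by convention. -/
theorem _root_.LiftsAngleField.hasFDerivAt : HasFDerivAt (fun z ↦ normalAngle (v z))
    (fderiv ℝ (fun z ↦ normalAngle (v z)) y) y := by
  refine DifferentiableAt.hasFDerivAt ?_
  by_contra h
  have h1 := hζ.angle
  rw [fderiv_zero_of_not_differentiableAt h] at h1
  simp at h1

theorem thetaForm_zero_apply (hn : 3 ≤ n) :
    thetaForm x₀ e v 0 y ζ = -Real.sin (normalAngle (v y)) := by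
  have h : uCoord e v 0 =ᶠ[nhds y] fun z ↦ Real.cos (normalAngle (v z)) := by
    filter_upwards [H.isOpen.mem_nhds hy] with z hz using H.uCoord_zero hn hz
  rw [H.thetaForm_apply hy hζ hn, h.fderiv_eq, hζ.hasFDerivAt.cos.fderiv]
  simp [hζ.angle]

theorem thetaForm_last_apply (hn : 3 ≤ n) :
    thetaForm x₀ e v (lastIndex n) y ζ = Real.cos (normalAngle (v y)) := by
  have h : uCoord e v (lastIndex n) =ᶠ[nhds y] fun z ↦ Real.sin (normalAngle (v z)) := by
    filter_upwards [H.isOpen.mem_nhds hy] with z hz using H.uCoord_last hn hz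
  rw [H.thetaForm_apply hy hζ hn, h.fderiv_eq, hζ.hasFDerivAt.sin.fderiv]
  simp [hζ.angle]

end IsAdaptedFrame

end Adapted

end

theorem mainTheorem3 {n : ℕ} [NeZero n] (hn : 3 ≤ n)
    {X : Type*} [TopologicalSpace X] [ChartedSpace (EuclideanHalfSpace n) X]
    [IsManifold (𝓡∂ n) ∞ X]
    [RiemannianBundle (fun x : X ↦ TangentSpace (𝓡∂ n) x)]
    [IsContMDiffRiemannianBundle (𝓡∂ n) ∞ (EuclideanSpace ℝ (Fin n))
      (fun x : X ↦ TangentSpace (𝓡∂ n) x)]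
    (o : TangentOrientation n X)
    -- a smooth map `z ↦ v z` (such as a local parametrization) from an open set `U` to `CSTM`,
    -- with base points in the domain of the chart at `x₀`
    (x₀ : X) {m : ℕ} {U : Set (EuclideanSpace ℝ (Fin m))} (hU : IsOpen U)
    {x : EuclideanSpace ℝ (Fin m) → X} {v : ∀ z, TangentSpace (𝓡∂ n) (x z)}
    (hv : ContMDiffOn 𝓘(ℝ, EuclideanSpace ℝ (Fin m)) (𝓡∂ n).tangent ∞
      (fun z ↦ (⟨x z, v z⟩ : TangentBundle (𝓡∂ n) X)) U)
    (hvC : ∀ z ∈ U, (⟨x z, v z⟩ : TangentBundle (𝓡∂ n) X) ∈ CSTM n X)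
    (hx₀ : ∀ z ∈ U, x z ∈ (chartAt (EuclideanHalfSpace n) x₀).source)
    -- an arbitrary frame, used for `Φ`
    {f : Fin n → ∀ z, TangentSpace (𝓡∂ n) (x z)} (hf : IsOrientedFrameAlong o U f)
    -- an adapted frame, used for the forms `Φ^M(i, j)`
    {e : Fin n → ∀ z, TangentSpace (𝓡∂ n) (x z)} (he : IsOrientedFrameAlong o U e)
    (he_first : ∀ z ∈ U, e 0 z = outwardNormal (x z))
    (he_last : ∀ z ∈ U, e (lastIndex n) z = equatorProj (v z))
    -- a tangent vector that is mapped to `∂/∂φ`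
    {y : EuclideanSpace ℝ (Fin m)} (hy : y ∈ U) {ζ : EuclideanSpace ℝ (Fin m)}
    (hζ : LiftsAngleField v y ζ) :
    interiorProd ζ (PhiForm x₀ f v y) =
      (1 / (((n - 2)‼ : ℝ) * sphereVolume n)) •
        ∑ ij ∈ regionD1 n, aCoeff n ij.1 ij.2 (normalAngle (v y)) • PhiM x₀ e ij.1 ij.2 y := by
  have H : IsAdaptedFrame o x₀ U v e :=
    ⟨hU, hx₀, fun z hz ↦ (hvC z hz).1, fun z hz ↦ (hvC z hz).2.1, he, he_first, he_last⟩
  have hPhi : ∀ k ∈ Finset.range ((n - 1) / 2 + 1), PhiK x₀ f v k y =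
      berezin _ n ((1 ⊗ₜ[ℝ] ExteriorAlgebra.ι ℝ fun A ↦ uCoord e v A y) *
      oddSum (fun A ↦ ExteriorAlgebra.ι ℝ (thetaForm x₀ e v A y)) ^ (n - 2 * k - 1) *
        evenSum (fun A B ↦ OmegaX x₀ e A B y) ^ k) := fun k hk ↦ by
    have hk' : 2 * k < n := by have := Finset.mem_range.1 hk; omega
    rw [PhiK_eq_of_frames hU hv hx₀ he hf hk' hy, PhiK_eq_berezin e hk']
  rw [PhiForm, interiorProd_eq, map_smul, Finset.sum_congr rfl fun k hk ↦ by rw [hPhi k hk]]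
  congr 1
  rw [contraction_sum_berezin hn (evalVec ζ) (normalAngle (v y))
    (u := fun A ↦ uCoord e v A y) (θ := fun A ↦ thetaForm x₀ e v A y)
    (Ω := fun A B ↦ OmegaX x₀ e A B y)
    (χ := fun s ↦ omegaX x₀ e 0 (midEmb n s) y)
    (ψ := fun s ↦ omegaX x₀ e (midEmb n s) (lastIndex n) y)
    (W := fun s t ↦ OmegaM x₀ e (midEmb n s) (midEmb n t) y)]
  · refine Finset.sum_congr rfl fun ij hij ↦ ?_
    rw [PhiM_eq_berezin hn e (Finset.mem_filter.1 hij).2]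
  · exact H.uCoord_zero hn hy
  · exact H.uCoord_last hn hy
  · exact H.uCoord_midEmb hn hy
  · exact H.thetaForm_zero_apply hy hζ hn
  · exact H.thetaForm_last_apply hy hζ hn
  · intro s
    rw [evalVec_apply, H.thetaForm_apply hy hζ hn, H.fderiv_uCoord_midEmb hn hy]
    rfl
  · intro A B b
    have h : OmegaX x₀ e A B y ∈ twoForms _ := curvForm_mem_twoForms _ _ A B y
    rw [contraction_mul_of_mem_twoForms _ h, H.contraction_OmegaX hy hζ, zero_mul, zero_add]
  · intro s
    rw [H.thetaForm_eq hn hy, H.fderiv_uCoord_midEmb hn hy, zero_add,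
      H.omegaX_antisymm (lastIndex n) _ hy, smul_neg, neg_smul]
  · exact fun s t b ↦ commute_of_mem_twoForms (curvForm_mem_twoForms _ _ _ _ y) b
  · exact fun s t ↦ H.OmegaX_eq_OmegaM_add (midEmb_ne_zero s) (midEmb_ne_zero t) hy
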